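/- Let $\kappa>0$, $\rho=-\frac{\kappa+4}{2}$, $c=13-6\frac{\kappa}{4}-6\frac{4}{\kappa}$, $h_{r,s}=\frac{\kappa}{16}(r^2-1)-\frac12(rs-1)+\frac{1}{\kappa}(s^2-1)$, $h_x=h_{1,2}=\frac{6-\kappa}{2\kappa}$ and $h_y=\frac{\rho(\rho+4-\kappa)}{4\kappa}$. On $\mathcal F=C^\infty(\{(x,y)\in\mathbb R^2: x\ne y\})[a_2,a_3,a_4,\ldots]$ (complex valued functions) consider the operators $$L_2=-\partial_{a_2}+\sum_{l\ge4}(l-3)a_{l-2}\,\partial_{a_l},\qquad L_1=\sum_{l\ge3}(l-2)a_{l-1}\,\partial_{a_l}+\partial_x+\partial_y,$$ $$L_0=\sum_{l\ge2}l\,a_l\,\partial_{a_l}+x\partial_x+y\partial_y+h_x+h_y,$$ $$L_{-1}=\sum_{l\ge2}\Big((l+2)a_{l+1}+\sum_{m_1+m_2=l+1}a_{m_1}a_{m_2}\Big)\partial_{a_l}+(x^2-3a_2)\partial_x+(y^2-3a_2)\partial_y+2xh_x+2yh_y,$$ $$L_{-2}=\sum_{l\ge2}\Big((l+4)a_{l+2}-4a_2a_l+3\!\!\sum_{m_1+m_2=l+2}\!\!a_{m_1}a_{m_2}+\!\!\sum_{m_1+m_2+m_3=l+2}\!\!a_{m_1}a_{m_2}a_{m_3}\Big)\partial_{a_l}+(x^3-4xa_2-5a_3)\partial_x+(y^3-4ya_2-5a_3)\partial_y+(3x^2-4a_2)h_x+(3y^2-4a_2)h_y-\tfrac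 c2a_2$$ (all $m_j\ge2$), and, for $n>2$, $L_n=\frac{1}{(n-2)!}[\cdots[[L_2,L_1],L_1]\cdots,L_1]$ and $L_{-n}=\frac1{(n-2)!}[L_{-1},[L_{-1},\cdots[L_{-1},L_{-2}]\cdots]]$ with $n-2$ brackets. Let $\mathcal U w\subset\mathcal F$ be the subspace of all $u\,w$ with $u$ a polynomial in the operators $L_n$, $n\in\mathbb Z$. The space of local martingales of SLE$_\kappa(\rho)$ is the kernel of $$A_{\kappa;\rho}=\frac\kappa2\partial_x^2+\frac{2}{y-x}\partial_y-\frac{\rho(\rho+4-\kappa)/(2\kappa)}{(y-x)^2}+2\sum_{l\ge2}\Big(\sum_{0\le m\le l-2,\;0\le r\le\lfloor (l-2-m)/2\rfloor}x^m(-1)^r\frac{(m+r)!}{m!\,r!}\sum_{k_1,\ldots,k_r\ge2,\ \sum k_j=l-m-2}a_{k_1}\cdots a_{k_r}\Big)\partial_{a_l}.$$ A highest weight (or singular) vector of weight $h$ is a $w\ne0$ with $L_0w=hw$ and $L_nw=0$ for all $n>0$. Powers and logarithms of $x-y$ are taken in the principal branch where $x<y$. Then the following hold. 1. The partition function $Z=(x-y)^{\rho/\kappa}=(x-y)^{-\frac12-\frac2\kappa}$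 lies in $\mathrm{Ker}\,A_{\kappa;\rho}$ and is a highest weight vector of weight $h_{2,1}=\frac{3\kappa-8}{16}$. 2. $(L_{-1}^2-\frac\kappa4L_{-2})Z=\frac{(\kappa-4)(\kappa-2)(\kappa+4)}{2\kappa^2}(x-y)^{\frac32-\frac2\kappa}$, and if $\kappa\notin\{2,4\}$ this is a (nonzero) singular vector of weight $h_{2,1}+2$. 3. The function $$\Lambda=\frac{(\kappa-4)(\kappa-2)(\kappa+4)}{2\kappa^2}\Big((x-y)^{\frac{3\kappa-4}{2\kappa}}\log(x-y)+(x-y)^{\frac{-\kappa-4}{2\kappa}}\,\frac{4\kappa x^2-(4\kappa+\kappa^2)y^2}{16}\Big)$$ lies in $\mathrm{Ker}\,A_{\kappa;\rho}$ and satisfies $(L_0-h_{2,1}-2)\Lambda=(L_{-1}^2-\frac\kappa4L_{-2})Z$; if $\kappa\ne\frac83$, then $L_n\Lambda\in\mathcal UZ$ for all $n>0$. 4. $(L_1^2-\frac\kappa4L_2)\Lambda=\beta Z$ with $\beta=-\frac1{16}(\kappa-4)(\kappa-2)(\kappa+4)$. 5. If $\kappa\notin\{2,4,\frac83\}$, then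 $\mathcal U\Lambda$ is a staggered module: $\mathcal UZ\subset\mathcal U\Lambda$ is a highest weight module of highest weight $h_{2,1}$, $\mathcal U\Lambda/\mathcal UZ$ is a highest weight module of highest weight $h_{2,1}+2$, and $L_0$ is not diagonalizable on $\mathcal U\Lambda$. Its logarithmic coupling is $\beta$: with $\chi=L_{-1}^2-\frac\kappa4L_{-2}$ and $\chi^\dagger=L_1^2-\frac\kappa4L_2$ there are a highest weight vector $\xi$ generating $\mathcal UZ$ and an $\eta\in\mathcal U\Lambda$ representing a highest weight vector that generates the quotient, such that $(L_0-h_{2,1}-2)\eta=\chi\xi$ is a (nonzero) singular vector and $\chi^\dagger\eta=\beta\xi$. -/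

import Mathlib

open scoped ContDiff

noncomputable section

namespace SLEVir

/-! ### The function space `𝓕 = C^∞({(x, y) ∈ ℝ² : x ≠ y})[a₂, a₃, a₄, …]` -/

/-- The domain `{(x, y) ∈ ℝ² : x ≠ y}`. -/
def Dom : Set (ℝ × ℝ) := {p | p.1 ≠ p.2}

lemma isOpen_Dom : IsOpen Dom := isOpen_ne_fun continuous_fst continuous_snd

/-- Extension by zero of a function on `Dom` to the plane. -/
def ext0 (f : Dom → ℂ) : ℝ × ℝ → ℂ := Function.extend Subtype.val f 0

lemma ext0_apply (f : Dom → ℂ) (p : Dom) : ext0 f p = f p :=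
  Subtype.val_injective.extend_apply f 0 p

lemma contDiffOn_ext0_iff {f : Dom → ℂ} {g : ℝ × ℝ → ℂ} (h : ∀ p : Dom, f p = g p) :
    ContDiffOn ℝ ∞ (ext0 f) Dom ↔ ContDiffOn ℝ ∞ g Dom :=
  contDiffOn_congr fun p hp => (ext0_apply f ⟨p, hp⟩).trans (h ⟨p, hp⟩)

/-- Complex valued smooth functions on `Dom`, as a subalgebra of all functions. -/
def smoothSubalgebra : Subalgebra ℂ (Dom → ℂ) where
  carrier := {f | ContDiffOn ℝ ∞ (ext0 f) Dom}
  mul_mem' {f g} hf hg := by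
    refine (contDiffOn_ext0_iff (g := fun p => ext0 f p * ext0 g p) fun p => ?_).2 (hf.mul hg)
    simp [ext0_apply]
  add_mem' {f g} hf hg := by
    refine (contDiffOn_ext0_iff (g := fun p => ext0 f p + ext0 g p) fun p => ?_).2 (hf.add hg)
    simp [ext0_apply]
  algebraMap_mem' c :=
    (contDiffOn_ext0_iff (g := fun _ => c) fun _ => rfl).2 contDiffOn_const

/-- The algebra `C^∞(Dom)` of complex valued smooth functions on `Dom`. -/
def Smooth : Type := smoothSubalgebra

instance : CommRing Smooth := inferInstanceAs (CommRing smoothSubalgebra)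

instance : Algebra ℂ Smooth := inferInstanceAs (Algebra ℂ smoothSubalgebra)

/-- The derivative of a function in `C^∞(Dom)` in the direction `v`. -/
def dirDeriv (v : ℝ × ℝ) : Smooth →ₗ[ℂ] Smooth where
  toFun f := ⟨fun p => fderiv ℝ (ext0 f.1) p v, by
    refine (contDiffOn_ext0_iff (g := fun p => fderiv ℝ (ext0 f.1) p v) fun _ => rfl).2 ?_
    exact (f.2.fderiv_of_isOpen (m := ∞) isOpen_Dom (by simp)).clm_apply contDiffOn_const⟩
  map_add' f g := by
    refine Subtype.ext (funext fun p => ?_)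
    have hd (f : Smooth) : DifferentiableAt ℝ (ext0 f.1) p :=
      (f.2.contDiffAt (isOpen_Dom.mem_nhds p.2)).differentiableAt (by simp)
    have he : ext0 (f + g).1 = ext0 f.1 + ext0 g.1 := by
      funext q
      by_cases hq : q ∈ Dom
      · have := ext0_apply (f + g).1 ⟨q, hq⟩
        have h1 := ext0_apply f.1 ⟨q, hq⟩
        have h2 := ext0_apply g.1 ⟨q, hq⟩
        rw [this, Pi.add_apply, h1, h2]
        rfl
      · simp [ext0, hq]
    change fderiv ℝ (ext0 (f + g).1) p v = fderiv ℝ (ext0 f.1) p v + fderiv ℝ (ext0 g.1) p v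
    rw [he, fderiv_add (hd f) (hd g)]
    rfl
  map_smul' c f := by
    refine Subtype.ext (funext fun p => ?_)
    have hd : DifferentiableAt ℝ (ext0 f.1) p :=
      (f.2.contDiffAt (isOpen_Dom.mem_nhds p.2)).differentiableAt (by simp)
    have he : ext0 (c • f).1 = c • ext0 f.1 := by
      funext q
      by_cases hq : q ∈ Dom
      · have := ext0_apply (c • f).1 ⟨q, hq⟩
        have h1 := ext0_apply f.1 ⟨q, hq⟩
        rw [this, Pi.smul_apply, h1]
        rfl
      · simp [ext0, hq]
    change fderiv ℝ (ext0 (c • f).1) p v = c * fderiv ℝ (ext0 f.1) p v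
    rw [he, fderiv_const_smul hd]
    rfl

/-- The indices `l ≥ 2` of the formal variables `a_l`. -/
abbrev Idx := {l : ℕ // 2 ≤ l}

/-- `𝓕 = C^∞({(x, y) : x ≠ y})[a₂, a₃, a₄, …]`. -/
abbrev 𝓕 := MvPolynomial Idx Smooth

/-- The variable `a_l` for `l ≥ 2`. With the convention `a₀ = a₁ = 0`, a sum of products
`a_{m₁} ⋯ a_{m_r}` over all `m_j ≥ 0` is the sum over `m_j ≥ 2`. -/
def a (l : ℕ) : 𝓕 := if h : 2 ≤ l then MvPolynomial.X ⟨l, h⟩ else 0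

/-- A smooth function of `(x, y)` as an element of `𝓕` without `a`-dependence. -/
def coe (f : Smooth) : 𝓕 := MvPolynomial.C f

/-! ### Explicit functions -/

/-- The coordinate function `x`. -/
def xS : Smooth := ⟨fun p => (p.1.1 : ℂ),
  (contDiffOn_ext0_iff (g := fun p => (p.1 : ℂ)) fun _ => rfl).2
    (Complex.ofRealCLM.contDiff.comp contDiff_fst).contDiffOn⟩

/-- The coordinate function `y`. -/
def yS : Smooth := ⟨fun p => (p.1.2 : ℂ),
  (contDiffOn_ext0_iff (g := fun p => (p.2 : ℂ)) fun _ => rfl).2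
    (Complex.ofRealCLM.contDiff.comp contDiff_snd).contDiffOn⟩

/-- A function `g (x - y)` of the difference. -/
def ofDiff (g : ℝ → ℂ) (hg : ContDiffOn ℝ ∞ g {0}ᶜ) : Smooth :=
  ⟨fun p => g (p.1.1 - p.1.2),
    (contDiffOn_ext0_iff (g := fun p => g (p.1 - p.2)) fun _ => rfl).2
      (hg.comp (contDiff_fst.sub contDiff_snd).contDiffOn fun _ hp => sub_ne_zero.2 hp)⟩

lemma contDiffOn_log : ContDiffOn ℝ ∞ (fun d : ℝ => Complex.log (d : ℂ)) {0}ᶜ := by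
  intro d hd
  refine ContDiffAt.contDiffWithinAt ?_
  have hcast (n : ℝ → ℝ) (hn : ContDiffAt ℝ ∞ n d) : ContDiffAt ℝ ∞ (fun t => (n t : ℂ)) d :=
    Complex.ofRealCLM.contDiff.contDiffAt.comp d hn
  rcases lt_or_gt_of_ne (show d ≠ 0 from hd) with h | h
  · have : ContDiffAt ℝ ∞ (fun t : ℝ => ((Real.log t : ℝ) : ℂ) + (Real.pi : ℂ) * Complex.I) d :=
      (hcast _ (Real.contDiffAt_log.2 hd)).add contDiffAt_const
    refine this.congr_of_eventuallyEq ?_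
    filter_upwards [eventually_lt_nhds h] with t ht
    apply Complex.ext
    · simp [Complex.log_re]
    · simp [Complex.log_im, Complex.arg_ofReal_of_neg ht]
  · refine (hcast _ (Real.contDiffAt_log.2 hd)).congr_of_eventuallyEq ?_
    filter_upwards [eventually_gt_nhds h] with t ht
    exact (Complex.ofReal_log ht.le).symm

lemma contDiffOn_cpow (s : ℂ) : ContDiffOn ℝ ∞ (fun d : ℝ => (d : ℂ) ^ s) {0}ᶜ := by
  have h : ContDiffOn ℝ ∞ (fun d : ℝ => Complex.exp (Complex.log (d : ℂ) * s)) {0}ᶜ :=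
    (contDiffOn_log.mul contDiffOn_const).cexp
  refine h.congr fun d hd => ?_
  exact Complex.cpow_def_of_ne_zero (Complex.ofReal_ne_zero.2 hd) s

lemma contDiffOn_neg_inv : ContDiffOn ℝ ∞ (fun d : ℝ => (-(d : ℂ))⁻¹) {0}ᶜ :=
  (Complex.ofRealCLM.contDiff.neg.contDiffOn).inv fun _ hd => by simpa using hd

/-- `(x - y) ^ s`, with the principal branch where `x < y`. -/
def powXY (s : ℝ) : Smooth := ofDiff (fun d => (d : ℂ) ^ (s : ℂ)) (contDiffOn_cpow s)

/-- `log (x - y)`, with the principal branch where `x < y`. -/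
def logXY : Smooth := ofDiff (fun d => Complex.log (d : ℂ)) contDiffOn_log

/-- `1 / (y - x)`. -/
def invYX : Smooth := ofDiff (fun d => (-(d : ℂ))⁻¹) contDiffOn_neg_inv

/-! ### Differential operators on `𝓕` -/

/-- Linear operators on `𝓕`; the product is composition and `⁅·, ·⁆` the commutator. -/
abbrev Op := Module.End ℂ 𝓕

/-- A linear operator on `C^∞(Dom)` applied to each coefficient of a polynomial in the `a_l`. -/
def coeffwise (D : Smooth →ₗ[ℂ] Smooth) : Op where
  toFun φ := AddMonoidAlgebra.map D.toAddMonoidHom φ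
  map_add' φ ψ := AddMonoidAlgebra.map_add _ φ ψ
  map_smul' c φ := by
    apply AddMonoidAlgebra.ext
    refine Finsupp.ext fun m => ?_
    exact D.map_smul c _

/-- `∂/∂x`. -/
def dX : Op := coeffwise (dirDeriv (1, 0))

/-- `∂/∂y`. -/
def dY : Op := coeffwise (dirDeriv (0, 1))

/-- `∑_{l ≥ 2} b_l ∂/∂a_l`. -/
def vecA (b : ℕ → 𝓕) : Op :=
  (MvPolynomial.mkDerivation Smooth (fun l : Idx => b l)).toLinearMap.restrictScalars ℂ

/-- Multiplication by an element of `𝓕`. -/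
def mulOp (φ : 𝓕) : Op := LinearMap.mulLeft ℂ φ

/-- `∑_{k₁ + ⋯ + k_r = n, k_j ≥ 2} a_{k₁} ⋯ a_{k_r}`. -/
def aSum (r n : ℕ) : 𝓕 := ∑ k ∈ Finset.Nat.antidiagonalTuple r n, ∏ j, a (k j)

/-- `x` as an element of `𝓕`. -/
def x : 𝓕 := coe xS

/-- `y` as an element of `𝓕`. -/
def y : 𝓕 := coe yS

/-- The constant `t` as an element of `𝓕`. -/
def const (t : ℂ) : 𝓕 := algebraMap ℂ 𝓕 t

/-- `L₂`. -/
def opL2 : Op := vecA fun l => if l = 2 then -1 else ((l : 𝓕) - 3) * a (l - 2)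

/-- `L₁`. -/
def opL1 : Op := vecA (fun l => ((l : 𝓕) - 2) * a (l - 1)) + dX + dY

/-- `L₀`. -/
def opL0 (hx hy : ℂ) : Op :=
  vecA (fun l => (l : 𝓕) * a l) + mulOp x * dX + mulOp y * dY + mulOp (const (hx + hy))

/-- `L₋₁`. -/
def opLm1 (hx hy : ℂ) : Op :=
  vecA (fun l => ((l : 𝓕) + 2) * a (l + 1) + aSum 2 (l + 1))
    + mulOp (x ^ 2 - 3 * a 2) * dX + mulOp (y ^ 2 - 3 * a 2) * dY
    + mulOp (2 * x * const hx + 2 * y * const hy)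

/-- `L₋₂`. -/
def opLm2 (c hx hy : ℂ) : Op :=
  vecA (fun l => ((l : 𝓕) + 4) * a (l + 2) - 4 * a 2 * a l + 3 * aSum 2 (l + 2) + aSum 3 (l + 2))
    + mulOp (x ^ 3 - 4 * x * a 2 - 5 * a 3) * dX
    + mulOp (y ^ 3 - 4 * y * a 2 - 5 * a 3) * dY
    + mulOp ((3 * x ^ 2 - 4 * a 2) * const hx + (3 * y ^ 2 - 4 * a 2) * const hy
        - const (c / 2) * a 2)

/-- The operators `L_n`, `n ∈ ℤ`, with
`L_n = [⋯[[L₂, L₁], L₁]⋯, L₁] / (n-2)!` and `L_{-n} = [L₋₁, [L₋₁, ⋯[L₋₁, L₋₂]⋯]] / (n-2)!`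
(`n - 2` brackets) for `n > 2`. -/
def opL (c hx hy : ℂ) : ℤ → Op
  | Int.ofNat 0 => opL0 hx hy
  | Int.ofNat 1 => opL1
  | Int.ofNat (k + 2) => ((k.factorial : ℂ)⁻¹) • (fun T : Op => ⁅T, opL1⁆)^[k] opL2
  | Int.negSucc 0 => opLm1 hx hy
  | Int.negSucc (k + 1) =>
      ((k.factorial : ℂ)⁻¹) • (fun T : Op => ⁅opLm1 hx hy, T⁆)^[k] (opLm2 c hx hy)

/-- The central charge `c(κ) = 13 - 6 κ/4 - 6 · 4/κ`. -/
def centralCharge (κ : ℝ) : ℝ := 13 - 6 * (κ / 4) - 6 * (4 / κ)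

/-- The Kac weights `h_{r,s}(κ)`. -/
def kacWeight (κ : ℝ) (r s : ℤ) : ℝ :=
  (κ / 4) / 4 * ((r : ℝ) ^ 2 - 1) - 1 / 2 * ((r : ℝ) * s - 1) + (4 / κ) / 4 * ((s : ℝ) ^ 2 - 1)

/-- The Virasoro generators on `𝓕` associated with SLE`_κ(ρ)`, that is `c = c(κ)`,
`h_x = h_{1,2}(κ)` and `h_y = ρ (ρ + 4 - κ) / (4 κ)`. -/
def vir (κ ρ : ℝ) : ℤ → Op :=
  opL (centralCharge κ : ℝ) (kacWeight κ 1 2 : ℝ) (ρ * (ρ + 4 - κ) / (4 * κ) : ℝ)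

/-- The drift operator `A_{κ;ρ}`: for SLE`_κ(ρ)` and `φ ∈ 𝓕`, the drift of
`φ(X_t, Y_t, a₂(t), a₃(t), …) / Z(X_t, Y_t)` is `(A_{κ;ρ} φ) / Z`. -/
def opA (κ ρ : ℝ) : Op :=
  ((κ / 2 : ℝ) : ℂ) • (dX * dX) + mulOp (2 * coe invYX) * dY
    - mulOp (const (ρ * (ρ + 4 - κ) / (2 * κ) : ℝ) * coe invYX ^ 2)
    + vecA (fun l => 2 * ∑ m ∈ Finset.range (l - 1), ∑ r ∈ Finset.range ((l - 2 - m) / 2 + 1),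
        x ^ m * (-1) ^ r * const (((m + r).factorial : ℂ) / (m.factorial * r.factorial))
          * aSum r (l - m - 2))

/-- The space `Ker A_{κ;ρ}` of local martingales of SLE`_κ(ρ)`. -/
def localMartingales (κ ρ : ℝ) : Submodule ℂ 𝓕 := LinearMap.ker (opA κ ρ)

/-- The partition function `Z = (x - y)^{ρ/κ}` of SLE`_κ(ρ)`. -/
def partitionFunction (κ ρ : ℝ) : 𝓕 := coe (powXY (ρ / κ))

/-! ### Highest weight vectors, staggered modules, logarithmic couplings

`L : ℤ → Module.End ℂ V` is the family of operators by which the Virasoro generators `L_n` act. -/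

section Modules

variable {V : Type*} [AddCommGroup V] [Module ℂ V] (L : ℤ → Module.End ℂ V)

/-- The submodule `𝒰 w` generated by `w`: all `u w` with `u` a polynomial in the `L_n`. -/
def generated (w : V) : Submodule ℂ V :=
  (Subalgebra.toSubmodule (Algebra.adjoin ℂ (Set.range L))).map (LinearMap.applyₗ w)

/-- `w` is a (nonzero) singular vector of weight `h`, i.e. the highest weight vector of the
highest weight module `𝒰 w`. -/
def IsHighestWeightVector (h : ℂ) (w : V) : Prop :=
  w ≠ 0 ∧ L 0 w = h • w ∧ ∀ n : ℤ, 0 < n → L n w = 0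

/-- For a submodule `H` of a module `S`: the class of `w ∈ S` in the quotient `S / H` is nonzero,
is a highest weight vector of weight `h`, and generates `S / H`. -/
def IsHighestWeightVectorMod (H S : Submodule ℂ V) (h : ℂ) (w : V) : Prop :=
  w ∈ S ∧ w ∉ H ∧ L 0 w - h • w ∈ H ∧ (∀ n : ℤ, 0 < n → L n w ∈ H) ∧ H ⊔ generated L w = S

/-- `S` is a staggered module with left module `H`, a highest weight module of highest weight
`hL`, and with right module `S / H`, a highest weight module of highest weight `hR`;
and `L₀` is not diagonalizable on `S`. -/
def IsStaggered (H S : Submodule ℂ V) (hL hR : ℂ) : Prop :=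
  H ≤ S ∧ (∀ n : ℤ, ∀ v ∈ S, L n v ∈ S) ∧
  (∃ ξ, IsHighestWeightVector L hL ξ ∧ generated L ξ = H) ∧
  (∃ η, IsHighestWeightVectorMod L H S hR η) ∧
  (⨆ μ : ℂ, S ⊓ Module.End.eigenspace (L 0) μ) ≠ S

/-- For a staggered module `S` with left module `H`: one can choose a highest weight vector `ξ`
generating `H` and `η ∈ S` over a highest weight vector of `S / H`, normalized by
`(L₀ - hR) η = χ ξ ≠ 0`, such that `χ† η = β ξ`. Here `χ ξ` is a singular vector of `H`, and
`χd` is the operator `χ†` obtained from `χ` by `(L_{n₁} ⋯ L_{n_k})† = L_{-n_k} ⋯ L_{-n₁}`. -/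
def IsLogCoupling (H S : Submodule ℂ V) (hL hR : ℂ) (χ χd : Module.End ℂ V) (β : ℂ) : Prop :=
  ∃ ξ η : V, IsHighestWeightVector L hL ξ ∧ generated L ξ = H ∧
    IsHighestWeightVectorMod L H S hR η ∧
    IsHighestWeightVector L hR (χ ξ) ∧ L 0 η - hR • η = χ ξ ∧ χd η = β • ξ

end Modules

/-! ### The case `ρ = -(κ+4)/2` -/

/-- `(κ-4)(κ-2)(κ+4) / (2κ²)`. -/
def singConst (κ : ℝ) : ℝ := (κ - 4) * (κ - 2) * (κ + 4) / (2 * κ ^ 2)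

/-- The logarithmic partner
`Λ = (κ-4)(κ-2)(κ+4)/(2κ²) · ((x-y)^{(3κ-4)/(2κ)} log(x-y)
  + (x-y)^{(-κ-4)/(2κ)} (4κx² - (4κ+κ²)y²)/16)`. -/
def logPartner (κ : ℝ) : 𝓕 :=
  coe ((singConst κ : ℂ) •
    (powXY ((3 * κ - 4) / (2 * κ)) * logXY
      + powXY ((-κ - 4) / (2 * κ)) *
        ((1 / 16 : ℂ) • ((4 * κ : ℂ) • xS ^ 2 - (4 * κ + κ ^ 2 : ℂ) • yS ^ 2))))

end SLEVir

end

/-!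
On functions of the difference, `A_{κ;ρ} (x-y)^s = p(s) (x-y)^{s-2}` with the indicial polynomial
`p(s) = κ/2 (s - ρ/κ) (s - (1 - 4/κ - ρ/κ))`, so that `Z = (x-y)^{ρ/κ}` is a local martingale. On
elements free of the `a_l`, the operators `L_n` with `n ≥ 2` vanish, and `L₁` and `L₀` are the Witt
fields `∑ z^k ∂_z` (up to a constant), which annihilate and rescale every power of `x - y`. Hence
every `(x-y)^s` is a highest weight vector, and the level two vector `χ Z`, a multiple of
`(x-y)^{ρ/κ+2}`, is singular.

For `ρ = -(κ+4)/2` the exponent `ρ/κ + 2` is the second root of `p`. As for resonant ordinary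
differential equations, this produces a logarithmic solution `Λ` over `χ Z`. It satisfies
`(L₀ - h_{2,1} - 2) Λ = χ Z`, and `L₁ Λ` is proportional to `L₋₁ Z`, except for `κ = 8/3`, where
`L₋₁ Z` vanishes. Since `[L₀, L_n] = -n L_n`, `L₀` is diagonalizable on `𝒰 Z` but not at `Λ`, so
that `Λ` is not in `𝒰 Z` and `𝒰 Λ` is staggered.
-/

noncomputable section

namespace SLEVir

/-- Evaluation of a smooth function at a point of `Dom`. -/
def ev (p : Dom) : Smooth →ₐ[ℂ] ℂ :=
  (Pi.evalAlgHom ℂ (fun _ : Dom => ℂ) p).comp smoothSubalgebra.val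

lemma smooth_ext {f g : Smooth} (h : ∀ p, ev p f = ev p g) : f = g :=
  Subtype.ext (funext h)

lemma ext0_eventuallyEq {f : Dom → ℂ} {g : ℝ × ℝ → ℂ} (h : ∀ p : Dom, f p = g p) (p : Dom) :
    ext0 f =ᶠ[nhds p.1] g := by
  filter_upwards [isOpen_Dom.mem_nhds p.2] with q hq
  exact (ext0_apply f ⟨q, hq⟩).trans (h ⟨q, hq⟩)

lemma contDiffAt_ext0 (f : Smooth) (p : Dom) : ContDiffAt ℝ ∞ (ext0 f.1) p :=
  f.2.contDiffAt (isOpen_Dom.mem_nhds p.2)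

lemma hasFDerivAt_ext0 (f : Smooth) (p : Dom) :
    HasFDerivAt (ext0 f.1) (fderiv ℝ (ext0 f.1) p) p :=
  ((contDiffAt_ext0 f p).differentiableAt (by simp)).hasFDerivAt

lemma ev_dirDeriv (v : ℝ × ℝ) (f : Smooth) (p : Dom) :
    ev p (dirDeriv v f) = fderiv ℝ (ext0 f.1) p v := rfl

lemma ev_dirDeriv_of_hasFDerivAt {v : ℝ × ℝ} {f : Smooth} {g : ℝ × ℝ → ℂ} {p : Dom}
    {g' : ℝ × ℝ →L[ℝ] ℂ} (h : ∀ q : Dom, ev q f = g q) (hg : HasFDerivAt g g' p) :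
    ev p (dirDeriv v f) = g' v :=
  DFunLike.congr_fun ((ext0_eventuallyEq (f := f.1) h p).fderiv_eq.trans hg.fderiv) v

lemma dirDeriv_mul (v : ℝ × ℝ) (f g : Smooth) :
    dirDeriv v (f * g) = f * dirDeriv v g + g * dirDeriv v f := by
  refine smooth_ext fun p => ?_
  have hmul (q : Dom) : ev q (f * g) = ext0 f.1 q * ext0 g.1 q := by
    rw [map_mul, ext0_apply, ext0_apply]; rfl
  rw [ev_dirDeriv_of_hasFDerivAt hmul ((hasFDerivAt_ext0 f p).mul (hasFDerivAt_ext0 g p))]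
  simp only [map_add, map_mul, ev_dirDeriv, ext0_apply]
  rfl

/-- The directional derivative `dirDeriv v` as a derivation of `C^∞(Dom)`. -/
def dirDer (v : ℝ × ℝ) : Derivation ℂ Smooth Smooth :=
  Derivation.mk' (dirDeriv v) (dirDeriv_mul v)

lemma dirDeriv_comm (v w : ℝ × ℝ) (f : Smooth) :
    dirDeriv v (dirDeriv w f) = dirDeriv w (dirDeriv v f) := by
  have second_deriv (v w : ℝ × ℝ) (p : Dom) :
      ev p (dirDeriv v (dirDeriv w f)) = fderiv ℝ (fderiv ℝ (ext0 f.1)) p v w := by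
    have hd : DifferentiableAt ℝ (fderiv ℝ (ext0 f.1)) p :=
      ((contDiffAt_ext0 f p).fderiv_right (m := 1) (by norm_cast)).differentiableAt (by simp)
    rw [ev_dirDeriv_of_hasFDerivAt (fun q => ev_dirDeriv w f q)
      (hd.hasFDerivAt.clm_apply (hasFDerivAt_const w _))]
    simp
  refine smooth_ext fun p => ?_
  rw [second_deriv, second_deriv]
  exact (contDiffAt_ext0 f p).isSymmSndFDerivAt (by simp; norm_cast) v w

lemma dirDeriv_xS (v : ℝ × ℝ) : dirDeriv v xS = algebraMap ℂ Smooth v.1 :=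
  smooth_ext fun p => (ev_dirDeriv_of_hasFDerivAt (fun _ => rfl)
    (Complex.ofRealCLM.hasFDerivAt.comp p.1 hasFDerivAt_fst)).trans ((ev p).commutes _).symm

lemma dirDeriv_yS (v : ℝ × ℝ) : dirDeriv v yS = algebraMap ℂ Smooth v.2 :=
  smooth_ext fun p => (ev_dirDeriv_of_hasFDerivAt (fun _ => rfl)
    (Complex.ofRealCLM.hasFDerivAt.comp p.1 hasFDerivAt_snd)).trans ((ev p).commutes _).symm

lemma dirDeriv_ofDiff (v : ℝ × ℝ) (c : ℂ) {g g' : ℝ → ℂ} (hg : ContDiffOn ℝ ∞ g {0}ᶜ)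
    (hg' : ContDiffOn ℝ ∞ g' {0}ᶜ) (hd : ∀ d : ℝ, d ≠ 0 → HasDerivAt g (c * g' d) d) :
    dirDeriv v (ofDiff g hg) = (((v.1 - v.2 : ℝ) : ℂ) * c) • ofDiff g' hg' := by
  refine smooth_ext fun p => ?_
  rw [ev_dirDeriv_of_hasFDerivAt (g := fun q => g (q.1 - q.2)) (fun _ => rfl)
    ((hd _ (sub_ne_zero.2 p.2)).hasFDerivAt.comp p.1 (hasFDerivAt_fst.sub hasFDerivAt_snd)),
    map_smul]
  simp only [ContinuousLinearMap.comp_apply, sub_apply,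
    ContinuousLinearMap.coe_fst', ContinuousLinearMap.coe_snd',
    ContinuousLinearMap.toSpanSingleton_apply, Complex.real_smul, smul_eq_mul, mul_assoc]
  rfl

lemma hasDerivAt_log_ofReal {d : ℝ} (hd : d ≠ 0) :
    HasDerivAt (fun t : ℝ => Complex.log (t : ℂ)) (d : ℂ)⁻¹ d := by
  have hlog : DifferentiableAt ℝ (fun t : ℝ => Complex.log (t : ℂ)) d :=
    (contDiffOn_log.contDiffAt (isOpen_compl_singleton.mem_nhds hd)).differentiableAt (by simp)
  -- The branch plays no role: differentiate `exp (log t) = t`.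
  have hexp : HasDerivAt (fun t : ℝ => (t : ℂ))
      (d * deriv (fun t : ℝ => Complex.log (t : ℂ)) d) d := by
    have h := hlog.hasDerivAt.cexp
    rw [Complex.exp_log (Complex.ofReal_ne_zero.2 hd)] at h
    refine h.congr_of_eventuallyEq ?_
    filter_upwards [eventually_ne_nhds hd] with t ht
    exact (Complex.exp_log (Complex.ofReal_ne_zero.2 ht)).symm
  have hone := hexp.unique Complex.ofRealCLM.hasDerivAt
  exact hlog.hasDerivAt.congr_deriv (eq_inv_of_mul_eq_one_right (by simpa using hone))

lemma hasDerivAt_ofReal_cpow_of_ne_zero (s : ℂ) {d : ℝ} (hd : d ≠ 0) :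
    HasDerivAt (fun t : ℝ => (t : ℂ) ^ s) (s * (d : ℂ) ^ (s - 1)) d := by
  have h := ((hasDerivAt_log_ofReal hd).mul_const s).cexp
  rw [← Complex.cpow_def_of_ne_zero (Complex.ofReal_ne_zero.2 hd) s] at h
  refine (h.congr_of_eventuallyEq ?_).congr_deriv ?_
  · filter_upwards [eventually_ne_nhds hd] with t ht
    exact Complex.cpow_def_of_ne_zero (Complex.ofReal_ne_zero.2 ht) s
  · rw [Complex.cpow_sub _ _ (Complex.ofReal_ne_zero.2 hd), Complex.cpow_one]; ring

/-! ### Powers and logarithms of `x - y` -/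

lemma powXY_add (s t : ℝ) : powXY (s + t) = powXY s * powXY t := by
  refine smooth_ext fun p => ?_
  have hd : ((p.1.1 - p.1.2 : ℝ) : ℂ) ≠ 0 := Complex.ofReal_ne_zero.2 (sub_ne_zero.2 p.2)
  exact (congrArg _ (Complex.ofReal_add s t)).trans (Complex.cpow_add _ _ hd)

lemma powXY_zero : powXY 0 = 1 :=
  smooth_ext fun _ => (congrArg _ Complex.ofReal_zero).trans (Complex.cpow_zero _)

lemma powXY_one : powXY 1 = xS - yS :=
  smooth_ext fun _ => ((congrArg _ Complex.ofReal_one).trans (Complex.cpow_one _)).trans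
    (Complex.ofReal_sub _ _)

lemma powXY_add_two (s : ℝ) : powXY (s + 2) = (xS - yS) ^ 2 * powXY s := by
  rw [← one_add_one_eq_two, ← add_assoc, powXY_add, powXY_add, powXY_one]; ring

lemma invYX_eq : invYX = -powXY (-1) := by
  refine smooth_ext fun p => ?_
  change (-((p.1.1 - p.1.2 : ℝ) : ℂ))⁻¹ = -((p.1.1 - p.1.2 : ℝ) : ℂ) ^ ((-1 : ℝ) : ℂ)
  rw [Complex.ofReal_neg, Complex.ofReal_one, Complex.cpow_neg_one, inv_neg]

lemma powXY_ne_zero (s : ℝ) : powXY s ≠ 0 := by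
  intro h
  have h01 : powXY (s + -s) = 0 := by rw [powXY_add, h, zero_mul]
  have hev := congrArg (ev ⟨(1, 0), one_ne_zero⟩) h01
  rw [add_neg_cancel, powXY_zero, map_one, map_zero] at hev
  exact one_ne_zero hev

lemma dirDeriv_powXY (v : ℝ × ℝ) (s : ℝ) :
    dirDeriv v (powXY s) = (((v.1 - v.2 : ℝ) : ℂ) * s) • powXY (s - 1) := by
  refine dirDeriv_ofDiff v s _ _ fun d hd => ?_
  simpa using hasDerivAt_ofReal_cpow_of_ne_zero s hd

lemma dirDeriv_logXY (v : ℝ × ℝ) :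
    dirDeriv v logXY = ((v.1 - v.2 : ℝ) : ℂ) • powXY (-1) := by
  rw [logXY, dirDeriv_ofDiff v 1 _ (contDiffOn_cpow (-1 : ℝ)) fun d hd => ?_, mul_one, powXY]
  simpa [Complex.cpow_neg_one] using hasDerivAt_log_ofReal hd

/-- The derivation `x ^ k ∂ₓ + y ^ k ∂ᵧ` of `C^∞(Dom)`: the part of `L_{1-k}` acting on the
variables `x`, `y`, up to the terms involving the `a_l`. -/
def wittField (k : ℕ) : Derivation ℂ Smooth Smooth :=
  xS ^ k • dirDer (1, 0) + yS ^ k • dirDer (0, 1)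

lemma wittField_apply (k : ℕ) (f : Smooth) :
    wittField k f = xS ^ k * dirDeriv (1, 0) f + yS ^ k * dirDeriv (0, 1) f := rfl

lemma wittField_xS (k : ℕ) : wittField k xS = xS ^ k := by
  simp [wittField_apply, dirDeriv_xS]

lemma wittField_yS (k : ℕ) : wittField k yS = yS ^ k := by
  simp [wittField_apply, dirDeriv_yS]

/-- `(x ^ k - y ^ k) / (x - y)`, the logarithmic derivative of `x - y` along `wittField k`. -/
def divDiff (k : ℕ) : Smooth := ∑ i ∈ Finset.range k, xS ^ i * yS ^ (k - 1 - i)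

lemma divDiff_mul_powXY_one (k : ℕ) : divDiff k * powXY 1 = xS ^ k - yS ^ k := by
  rw [powXY_one, divDiff, geom_sum₂_mul]

lemma wittField_powXY (k : ℕ) (s : ℝ) :
    wittField k (powXY s) = (s : ℂ) • (divDiff k * powXY s) := by
  have h : divDiff k * powXY s = (xS ^ k - yS ^ k) * powXY (s - 1) := by
    rw [← divDiff_mul_powXY_one, mul_assoc, ← powXY_add, add_sub_cancel]
  rw [wittField_apply, dirDeriv_powXY, dirDeriv_powXY, h]
  simp only [sub_zero, zero_sub, Complex.ofReal_neg, Complex.ofReal_one, Algebra.smul_def, map_mul,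
    map_neg, map_one]
  ring

lemma wittField_logXY (k : ℕ) : wittField k logXY = divDiff k := by
  have h : divDiff k = (xS ^ k - yS ^ k) * powXY (-1) := by
    rw [← divDiff_mul_powXY_one, mul_assoc, ← powXY_add, add_neg_cancel, powXY_zero, mul_one]
  rw [wittField_apply, dirDeriv_logXY, dirDeriv_logXY, h]
  simp only [sub_zero, zero_sub, Complex.ofReal_neg, Complex.ofReal_one, Algebra.smul_def,
    map_neg, map_one]
  ring

lemma divDiff_zero : divDiff 0 = 0 := rfl

lemma divDiff_one : divDiff 1 = 1 := by simp [divDiff]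

lemma divDiff_two : divDiff 2 = xS + yS := by
  simp [divDiff, Finset.sum_range_succ, add_comm]

lemma divDiff_three : divDiff 3 = xS ^ 2 + xS * yS + yS ^ 2 := by
  simp [divDiff, Finset.sum_range_succ]; ring

/-! ### Operators on functions of `x` and `y` -/

lemma coe_add (f g : Smooth) : coe (f + g) = coe f + coe g := map_add _ f g

lemma coe_sub (f g : Smooth) : coe (f - g) = coe f - coe g := map_sub _ f g

lemma coe_mul (f g : Smooth) : coe (f * g) = coe f * coe g := map_mul _ f g

lemma coe_pow (f : Smooth) (n : ℕ) : coe (f ^ n) = coe f ^ n := map_pow _ f n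

lemma coe_smul (t : ℂ) (f : Smooth) : coe (t • f) = t • coe f :=
  map_smul (IsScalarTower.toAlgHom ℂ Smooth 𝓕) t f

lemma coe_zero : coe 0 = 0 := map_zero _

lemma coe_injective : Function.Injective coe := MvPolynomial.C_injective Idx Smooth

lemma coe_powXY_ne_zero (s : ℝ) : coe (powXY s) ≠ 0 :=
  fun h => powXY_ne_zero s (coe_injective (h.trans coe_zero.symm))

lemma coeffwise_monomial (D : Smooth →ₗ[ℂ] Smooth) (m : Idx →₀ ℕ) (f : Smooth) :
    coeffwise D (MvPolynomial.monomial m f) = MvPolynomial.monomial m (D f) :=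
  AddMonoidAlgebra.map_single _ f m

lemma dX_coe (f : Smooth) : dX (coe f) = coe (dirDeriv (1, 0) f) := coeffwise_monomial _ 0 f

lemma dY_coe (f : Smooth) : dY (coe f) = coe (dirDeriv (0, 1) f) := coeffwise_monomial _ 0 f

lemma vecA_coe (b : ℕ → 𝓕) (f : Smooth) : vecA b (coe f) = 0 :=
  (MvPolynomial.mkDerivation Smooth (fun l : Idx => b l)).map_algebraMap f

lemma vecA_add_mulOp_apply_coe (b : ℕ → 𝓕) (g₁ g₂ g : 𝓕) (f : Smooth) :
    (vecA b + mulOp g₁ * dX + mulOp g₂ * dY + mulOp g) (coe f)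
      = g₁ * coe (dirDeriv (1, 0) f) + g₂ * coe (dirDeriv (0, 1) f) + g * coe f := by
  rw [← dX_coe, ← dY_coe, ← zero_add (g₁ * _), ← vecA_coe b f]
  rfl

lemma coe_wittField (k : ℕ) (f : Smooth) :
    coe (wittField k f) = x ^ k * coe (dirDeriv (1, 0) f) + y ^ k * coe (dirDeriv (0, 1) f) := by
  rw [wittField_apply, coe_add, coe_mul, coe_mul, coe_pow, coe_pow, x, y]

lemma opL1_coe (f : Smooth) : opL1 (coe f) = coe (wittField 0 f) := by
  rw [opL1, LinearMap.add_apply, LinearMap.add_apply, vecA_coe, dX_coe, dY_coe, coe_wittField]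
  ring

lemma opL0_coe (hx hy : ℂ) (f : Smooth) :
    opL0 hx hy (coe f) = coe (wittField 1 f + (hx + hy) • f) := by
  rw [opL0, vecA_add_mulOp_apply_coe, coe_add, coe_wittField, coe_smul, const]
  algebra with ℂ

lemma opLm1_coe (hx hy : ℂ) (f : Smooth) :
    opLm1 hx hy (coe f) = coe (wittField 2 f + ((2 * hx) • xS + (2 * hy) • yS) * f)
      - a 2 * coe ((3 : ℂ) • wittField 0 f) := by
  rw [opLm1, vecA_add_mulOp_apply_coe]
  simp only [coe_add, coe_mul, coe_wittField, coe_smul, const, x, y]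
  algebra with ℂ

lemma opLm2_coe (c hx hy : ℂ) (f : Smooth) :
    opLm2 c hx hy (coe f)
      = coe (wittField 3 f + ((3 * hx) • xS ^ 2 + (3 * hy) • yS ^ 2) * f)
        - a 2 * coe ((4 : ℂ) • wittField 1 f + (4 * hx + 4 * hy + c / 2) • f)
        - a 3 * coe ((5 : ℂ) • wittField 0 f) := by
  rw [opLm2, vecA_add_mulOp_apply_coe]
  simp only [coe_add, coe_mul, coe_pow, coe_wittField, coe_smul, const, x, y]
  algebra with ℂ

lemma opL_natCast_add_two (c hx hy : ℂ) (k : ℕ) :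
    opL c hx hy ((k : ℤ) + 2) = ((k.factorial : ℂ)⁻¹) • (fun T : Op => ⁅T, opL1⁆)^[k] opL2 := rfl

lemma opL_coe_of_two_le (c hx hy : ℂ) {n : ℤ} (hn : 2 ≤ n) (f : Smooth) :
    opL c hx hy n (coe f) = 0 := by
  obtain ⟨k, hk⟩ := Int.eq_ofNat_of_zero_le (sub_nonneg.2 hn)
  have iterate_coe (f : Smooth) : (fun T : Op => ⁅T, opL1⁆)^[k] opL2 (coe f) = 0 := by
    clear hk
    induction k generalizing f with
    | zero => rw [Function.iterate_zero_apply]; exact vecA_coe _ f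
    | succ k ih =>
      rw [Function.iterate_succ_apply', Ring.lie_def, LinearMap.sub_apply, Module.End.mul_apply,
        Module.End.mul_apply, ih, opL1_coe, ih, map_zero, sub_zero]
  rw [eq_add_of_sub_eq hk, opL_natCast_add_two, LinearMap.smul_apply, iterate_coe, smul_zero]

/-! ### Powers of `x - y` as highest weight vectors -/

lemma isHighestWeightVector_coe_powXY (c hx hy : ℂ) (s : ℝ) :
    IsHighestWeightVector (opL c hx hy) (s + hx + hy) (coe (powXY s)) := by
  refine ⟨coe_powXY_ne_zero s, ?_, fun n hn => ?_⟩
  · change opL0 hx hy _ = _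
    rw [opL0_coe, wittField_powXY, divDiff_one, one_mul, ← add_smul, coe_smul, add_assoc]
  · obtain rfl | h2 : n = 1 ∨ 2 ≤ n := by lia
    · change opL1 _ = 0
      rw [opL1_coe, wittField_powXY, divDiff_zero, zero_mul, smul_zero, coe_zero]
    · exact opL_coe_of_two_le c hx hy h2 _

lemma opLm1_coe_powXY (hx hy : ℂ) (s : ℝ) :
    opLm1 hx hy (coe (powXY s))
      = coe (((s + 2 * hx) • xS + (s + 2 * hy) • yS) * powXY s) := by
  rw [opLm1_coe, wittField_powXY, wittField_powXY, divDiff_zero, divDiff_two, zero_mul,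
    smul_zero, smul_zero, coe_zero, mul_zero, sub_zero]
  congr 1
  algebra

lemma opLm1_sq_coe_powXY (hx hy : ℂ) (s : ℝ) :
    (opLm1 hx hy ^ 2) (coe (powXY s))
      = coe (((s + 2 * hx) • xS ^ 2 + (s + 2 * hy) • yS ^ 2
          + ((s + 2 * hx) • xS + (s + 2 * hy) • yS) ^ 2) * powXY s)
        - a 2 * coe ((6 * (s + hx + hy)) • powXY s) := by
  rw [pow_two, Module.End.mul_apply, opLm1_coe_powXY, opLm1_coe]
  simp only [Derivation.leibniz, smul_eq_mul, map_add, Derivation.map_smul, wittField_xS,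
    wittField_yS, wittField_powXY, divDiff_zero, divDiff_two]
  congr 2
  · algebra
  · congr 1; algebra

lemma opLm2_coe_powXY (c hx hy : ℂ) (s : ℝ) :
    opLm2 c hx hy (coe (powXY s))
      = coe (((s + 3 * hx) • xS ^ 2 + (s : ℂ) • (xS * yS) + (s + 3 * hy) • yS ^ 2) * powXY s)
        - a 2 * coe ((4 * (s + hx + hy) + c / 2) • powXY s) := by
  rw [opLm2_coe]
  simp only [wittField_powXY, divDiff_zero, divDiff_one, divDiff_three, zero_mul, smul_zero,
    coe_zero, mul_zero, sub_zero]
  congr 2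
  · algebra
  · congr 1; algebra

lemma levelTwo_coe_powXY {c hx hy t k : ℂ} {s : ℝ}
    (hxx : s + 2 * hx + (s + 2 * hx) ^ 2 - t * (s + 3 * hx) = k)
    (hxy : 2 * (s + 2 * hx) * (s + 2 * hy) - t * s = -(2 * k))
    (hyy : s + 2 * hy + (s + 2 * hy) ^ 2 - t * (s + 3 * hy) = k)
    (ha : 6 * (s + hx + hy) = t * (4 * (s + hx + hy) + c / 2)) :
    (opLm1 hx hy ^ 2 - t • opLm2 c hx hy) (coe (powXY s)) = k • coe (powXY (s + 2)) := by
  have hfun : ((s + 2 * hx) • xS ^ 2 + (s + 2 * hy) • yS ^ 2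
        + ((s + 2 * hx) • xS + (s + 2 * hy) • yS) ^ 2) * powXY s
      - t • (((s + 3 * hx) • xS ^ 2 + (s : ℂ) • (xS * yS) + (s + 3 * hy) • yS ^ 2) * powXY s)
      = k • powXY (s + 2) := by
    trans (k • xS ^ 2 + (-(2 * k)) • (xS * yS) + k • yS ^ 2) * powXY s
    · nth_rw 1 [← hxx]
      rw [← hxy, ← hyy]
      algebra
    · rw [powXY_add_two]
      algebra
  rw [LinearMap.sub_apply, LinearMap.smul_apply, opLm1_sq_coe_powXY, opLm2_coe_powXY, ha,
    ← coe_smul k, ← hfun]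
  simp only [coe_sub, coe_smul]
  algebra with ℂ

/-! ### Logarithmic functions -/

/-- The functions `(x - y) ^ (s + 2) log (x - y) + (x - y) ^ s (A x² + B y²)`, among which the
logarithmic partner is sought. -/
def logXYAnsatz (s : ℝ) (A B : ℂ) : Smooth :=
  powXY (s + 2) * logXY + powXY s * (A • xS ^ 2 + B • yS ^ 2)

lemma opL0_coe_logXYAnsatz (hx hy : ℂ) (s : ℝ) (A B : ℂ) :
    opL0 hx hy (coe (logXYAnsatz s A B))
      = (s + hx + hy + 2) • coe (logXYAnsatz s A B) + coe (powXY (s + 2)) := by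
  rw [opL0_coe, ← coe_smul, ← coe_add]
  congr 1
  simp only [logXYAnsatz, map_add, Derivation.map_smul, Derivation.leibniz, Derivation.leibniz_pow,
    smul_eq_mul, wittField_xS, wittField_yS, wittField_powXY, wittField_logXY, divDiff_one,
    Complex.ofReal_add, Complex.ofReal_ofNat]
  algebra

lemma opL1_coe_logXYAnsatz (s : ℝ) (A B : ℂ) :
    opL1 (coe (logXYAnsatz s A B)) = coe (((2 * A) • xS + (2 * B) • yS) * powXY s) := by
  rw [opL1_coe]
  congr 1
  simp only [logXYAnsatz, map_add, Derivation.map_smul, Derivation.leibniz, Derivation.leibniz_pow,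
    smul_eq_mul, wittField_xS, wittField_yS, wittField_powXY, wittField_logXY, divDiff_zero]
  algebra

lemma opL1_sq_coe_logXYAnsatz (s : ℝ) (A B : ℂ) :
    (opL1 ^ 2) (coe (logXYAnsatz s A B)) = (2 * (A + B)) • coe (powXY s) := by
  rw [pow_two, Module.End.mul_apply, opL1_coe_logXYAnsatz, opL1_coe, ← coe_smul]
  congr 1
  simp only [map_add, Derivation.map_smul, Derivation.leibniz, smul_eq_mul, wittField_xS,
    wittField_yS, wittField_powXY, divDiff_zero]
  algebra

lemma dirDeriv_one (v : ℝ × ℝ) : dirDeriv v 1 = 0 := (dirDer v).map_one_eq_zero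

/-! ### The drift operator -/

/-- The indicial polynomial of `A_{κ;ρ}`: the factor by which `A_{κ;ρ}` maps `(x - y) ^ s` to
`(x - y) ^ (s - 2)`. -/
def indicial (κ ρ s : ℝ) : ℝ := κ / 2 * (s * (s - 1)) + 2 * s - ρ * (ρ + 4 - κ) / (2 * κ)

lemma opA_coe (κ ρ : ℝ) (f : Smooth) :
    opA κ ρ (coe f) = coe (((κ / 2 : ℝ) : ℂ) • dirDeriv (1, 0) (dirDeriv (1, 0) f)
      - (2 : ℂ) • (powXY (-1) * dirDeriv (0, 1) f)
      - ((ρ * (ρ + 4 - κ) / (2 * κ) : ℝ) : ℂ) • (powXY (-1) ^ 2 * f)) := by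
  rw [opA, LinearMap.add_apply, vecA_coe, add_zero, invYX_eq]
  change ((κ / 2 : ℝ) : ℂ) • dX (dX (coe f)) + 2 * coe (-powXY (-1)) * dY (coe f)
    - const (ρ * (ρ + 4 - κ) / (2 * κ) : ℝ) * coe (-powXY (-1)) ^ 2 * coe f = _
  rw [dX_coe, dX_coe, dY_coe, ← neg_one_smul ℂ (powXY (-1))]
  simp only [coe_sub, coe_smul, coe_mul, coe_pow, const]
  algebra with ℂ

lemma opA_coe_powXY_mul (κ ρ s : ℝ) (f : Smooth) :
    opA κ ρ (coe (powXY s * f)) = coe (((indicial κ ρ s : ℝ) : ℂ) • (powXY (s - 2) * f)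
      + powXY (s - 1) * (((κ * s : ℝ) : ℂ) • dirDeriv (1, 0) f - (2 : ℂ) • dirDeriv (0, 1) f)
      + ((κ / 2 : ℝ) : ℂ) • (powXY s * dirDeriv (1, 0) (dirDeriv (1, 0) f))) := by
  have hs1 : powXY (s - 1) = powXY s * powXY (-1) := powXY_add s (-1)
  have hneg2 : powXY (-1 - 1) = powXY (-1) ^ 2 := by
    rw [pow_two, ← powXY_add, sub_eq_add_neg]
  have hs2 : powXY (s - 2) = powXY s * powXY (-1) ^ 2 := by
    rw [← hneg2, ← powXY_add]; congr 1; ring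
  rw [opA_coe]
  congr 1
  simp only [dirDeriv_mul, dirDeriv_powXY, map_add, map_smul, hs1, hneg2, hs2, indicial]
  push_cast
  algebra

lemma opA_coe_powXY (κ ρ s : ℝ) :
    opA κ ρ (coe (powXY s)) = (indicial κ ρ s : ℂ) • coe (powXY (s - 2)) := by
  have h := opA_coe_powXY_mul κ ρ s 1
  simpa only [mul_one, dirDeriv_one, map_zero, smul_zero, sub_zero, mul_zero, add_zero,
    coe_smul] using h

lemma opA_coe_powXY_mul_logXY (κ ρ s : ℝ) :
    opA κ ρ (coe (powXY s * logXY)) = (indicial κ ρ s : ℂ) • coe (powXY (s - 2) * logXY)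
      + ((κ / 2 * (2 * s - 1) + 2 : ℝ) : ℂ) • coe (powXY (s - 2)) := by
  have hs1 : powXY (s - 2) = powXY (s - 1) * powXY (-1) := by rw [← powXY_add]; congr 1; ring
  have hs2 : powXY (s - 2) = powXY s * powXY (-1 - 1) := by rw [← powXY_add]; congr 1; ring
  rw [opA_coe_powXY_mul, ← coe_smul, ← coe_smul, ← coe_add, add_assoc]
  congr 2
  simp only [dirDeriv_logXY, map_smul, dirDeriv_powXY, mul_smul_comm, mul_sub, ← hs1, ← hs2]
  push_cast
  algebra

lemma opA_coe_powXY_mul_quadratic (κ ρ s : ℝ) (A B : ℂ) :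
    opA κ ρ (coe (powXY s * (A • xS ^ 2 + B • yS ^ 2)))
      = coe ((indicial κ ρ s : ℂ) • (powXY (s - 2) * (A • xS ^ 2 + B • yS ^ 2))
        + powXY (s - 1) * ((2 * κ * s * A) • xS - (4 * B) • yS) + (κ * A) • powXY s) := by
  rw [opA_coe_powXY_mul]
  congr 1
  simp only [pow_two, dirDeriv_mul, dirDeriv_xS, dirDeriv_yS, map_add, map_smul, map_zero,
    Complex.ofReal_zero, Complex.ofReal_one, map_one, dirDeriv_one]
  push_cast
  algebra

/-! ### The grading by `L₀` -/

lemma coeffwise_mul (D : Derivation ℂ Smooth Smooth) (φ ψ : 𝓕) :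
    coeffwise D (φ * ψ) = φ * coeffwise D ψ + ψ * coeffwise D φ := by
  induction φ using MvPolynomial.induction_on' with
  | monomial m f =>
    induction ψ using MvPolynomial.induction_on' with
    | monomial n g =>
      simp only [MvPolynomial.monomial_mul, coeffwise_monomial, Derivation.coeFn_coe,
        Derivation.leibniz, smul_eq_mul, map_add, add_comm n m]
    | add ψ₁ ψ₂ h₁ h₂ => rw [mul_add, map_add, h₁, h₂, map_add]; ring
  | add φ₁ φ₂ h₁ h₂ => rw [add_mul, map_add, h₁, h₂, map_add]; ring

/-- The first order operator `∑ b_l ∂/∂a_l + g₁ ∂/∂x + g₂ ∂/∂y` as a derivation of `𝓕`. -/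
def firstOrder (b : ℕ → 𝓕) (g₁ g₂ : 𝓕) : Derivation ℂ 𝓕 𝓕 :=
  (MvPolynomial.mkDerivation Smooth (fun l : Idx => b l)).restrictScalars ℂ
    + g₁ • Derivation.mk' dX (coeffwise_mul (dirDer (1, 0)))
    + g₂ • Derivation.mk' dY (coeffwise_mul (dirDer (0, 1)))

lemma coe_firstOrder (b : ℕ → 𝓕) (g₁ g₂ : 𝓕) :
    (firstOrder b g₁ g₂ : Op) = vecA b + mulOp g₁ * dX + mulOp g₂ * dY := rfl

lemma firstOrder_coe (b : ℕ → 𝓕) (g₁ g₂ : 𝓕) (f : Smooth) :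
    firstOrder b g₁ g₂ (coe f)
      = g₁ * coe (dirDeriv (1, 0) f) + g₂ * coe (dirDeriv (0, 1) f) := by
  rw [← dX_coe, ← dY_coe, ← zero_add (g₁ * _), ← vecA_coe b f]
  rfl

lemma coeffwise_X (D : Derivation ℂ Smooth Smooth) (l : Idx) :
    coeffwise D (MvPolynomial.X l) = 0 := by
  rw [MvPolynomial.X, coeffwise_monomial, Derivation.coeFn_coe, D.map_one_eq_zero, map_zero]

lemma firstOrder_X (b : ℕ → 𝓕) (g₁ g₂ : 𝓕) (l : Idx) :
    firstOrder b g₁ g₂ (MvPolynomial.X l) = b l := by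
  change vecA b (MvPolynomial.X l) + g₁ * coeffwise (dirDer (1, 0)) (MvPolynomial.X l)
    + g₂ * coeffwise (dirDer (0, 1)) (MvPolynomial.X l) = _
  rw [coeffwise_X, coeffwise_X, mul_zero, mul_zero, add_zero, add_zero]
  exact MvPolynomial.mkDerivation_X Smooth _ l

lemma derivation_ext {D₁ D₂ : Derivation ℂ 𝓕 𝓕} (hC : ∀ f, D₁ (coe f) = D₂ (coe f))
    (hX : ∀ l : Idx, D₁ (MvPolynomial.X l) = D₂ (MvPolynomial.X l)) : D₁ = D₂ := by
  refine Derivation.ext fun φ => ?_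
  induction φ using MvPolynomial.induction_on with
  | C f => exact hC f
  | add φ ψ h₁ h₂ => rw [map_add, map_add, h₁, h₂]
  | mul_X φ l h => rw [Derivation.leibniz, Derivation.leibniz, h, hX]

lemma derivation_ofNat (D : Derivation ℂ 𝓕 𝓕) (n : ℕ) [n.AtLeastTwo] :
    D ofNat(n) = 0 := by
  rw [← Nat.cast_ofNat, D.map_natCast]

/-- The Euler field `∑ l a_l ∂/∂a_l + x ∂/∂x + y ∂/∂y`, the first order part of `L₀`. It defines
the grading of `𝓕` in which `x` and `y` have weight `1` and `a_l` has weight `l`: an element `φ`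
is homogeneous of weight `n` if `euler φ = n • φ`. -/
def euler : Derivation ℂ 𝓕 𝓕 := firstOrder (fun l => (l : 𝓕) * a l) x y

lemma opL0_eq (hx hy : ℂ) : opL0 hx hy = (euler : Op) + mulOp (const (hx + hy)) := rfl

lemma euler_a (l : ℕ) : euler (a l) = (l : ℂ) • a l := by
  by_cases hl : 2 ≤ l
  · have hX : a l = MvPolynomial.X ⟨l, hl⟩ := dif_pos hl
    conv_lhs => rw [hX]
    rw [euler, firstOrder_X, Algebra.smul_def, map_natCast]
  · rw [a, dif_neg hl, map_zero, smul_zero]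

lemma euler_x : euler x = x := by
  rw [euler, x, firstOrder_coe, dirDeriv_xS, dirDeriv_xS]
  simp [coe]

lemma euler_y : euler y = y := by
  rw [euler, y, firstOrder_coe, dirDeriv_yS, dirDeriv_yS]
  simp [coe]

lemma euler_prod {ι : Type*} (s : Finset ι) {φ : ι → 𝓕} {n : ι → ℂ}
    (h : ∀ i ∈ s, euler (φ i) = n i • φ i) :
    euler (∏ i ∈ s, φ i) = (∑ i ∈ s, n i) • ∏ i ∈ s, φ i := by
  classical
  induction s using Finset.induction_on with
  | empty => simp
  | insert i s hi ih =>
    rw [Finset.prod_insert hi, Finset.sum_insert hi, Derivation.leibniz,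
      h i (Finset.mem_insert_self i s), ih fun j hj => h j (Finset.mem_insert_of_mem hj)]
    simp only [smul_eq_mul]
    algebra with ℂ

lemma euler_aSum (r n : ℕ) : euler (aSum r n) = (n : ℂ) • aSum r n := by
  rw [aSum, map_sum, Finset.smul_sum]
  refine Finset.sum_congr rfl fun k hk => ?_
  rw [euler_prod _ fun j _ => euler_a (k j), ← Finset.Nat.mem_antidiagonalTuple.1 hk, Nat.cast_sum]

lemma lie_euler_firstOrder {n : ℂ} {b : ℕ → 𝓕} {g₁ g₂ : 𝓕}
    (hb : ∀ l : ℕ, 2 ≤ l → euler (b l) = (n + l) • b l) (h₁ : euler g₁ = (n + 1) • g₁)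
    (h₂ : euler g₂ = (n + 1) • g₂) : ⁅euler, firstOrder b g₁ g₂⁆ = n • firstOrder b g₁ g₂ := by
  refine derivation_ext (fun f => ?_) (fun l => ?_)
  · have euler_coe (f : Smooth) :
        euler (coe f) = x * coe (dirDeriv (1, 0) f) + y * coe (dirDeriv (0, 1) f) :=
      firstOrder_coe _ _ _ f
    rw [Derivation.commutator_apply, Derivation.smul_apply, euler_coe, firstOrder_coe]
    simp only [map_add, Derivation.leibniz, smul_eq_mul, h₁, h₂, euler_coe, firstOrder_coe, x, y,
      dirDeriv_xS, dirDeriv_yS, dirDeriv_comm (0, 1) (1, 0), Complex.ofReal_one,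
      Complex.ofReal_zero, map_one, map_zero]
    rw [show coe 1 = 1 from map_one _, coe_zero]
    algebra with ℂ
  · rw [Derivation.commutator_apply, Derivation.smul_apply, firstOrder_X, hb l l.2]
    have hX : euler (MvPolynomial.X l) = ((l : ℕ) : ℂ) • MvPolynomial.X l := by
      simpa only [a, dif_pos l.2] using euler_a l
    rw [hX, Derivation.map_smul, firstOrder_X]
    module

lemma lie_coe_add_mulOp {D E : Derivation ℂ 𝓕 𝓕} {n : ℂ} {g : 𝓕} (hD : ⁅E, D⁆ = n • D)
    (hg : E g = n • g) (t : ℂ) :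
    ⁅(E : Op) + mulOp (const t), (D : Op) + mulOp g⁆ = n • ((D : Op) + mulOp g) := by
  refine LinearMap.ext fun φ => ?_
  have hDφ := DFunLike.congr_fun hD φ
  rw [Derivation.commutator_apply, Derivation.smul_apply] at hDφ
  change (E (D φ + g * φ) + const t * (D φ + g * φ))
    - (D (E φ + const t * φ) + g * (E φ + const t * φ)) = n • (D φ + g * φ)
  rw [smul_add, ← hDφ]
  simp only [const, map_add, Derivation.leibniz, smul_eq_mul, hg, Derivation.map_algebraMap]
  algebra with ℂ

lemma lie_opL0 {hx hy n : ℂ} {b : ℕ → 𝓕} {g₁ g₂ g : 𝓕}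
    (hb : ∀ l : ℕ, 2 ≤ l → euler (b l) = (n + l) • b l) (h₁ : euler g₁ = (n + 1) • g₁)
    (h₂ : euler g₂ = (n + 1) • g₂) (hg : euler g = n • g) :
    ⁅opL0 hx hy, vecA b + mulOp g₁ * dX + mulOp g₂ * dY + mulOp g⁆
      = n • (vecA b + mulOp g₁ * dX + mulOp g₂ * dY + mulOp g) := by
  rw [opL0_eq, ← coe_firstOrder]
  exact lie_coe_add_mulOp (lie_euler_firstOrder hb h₁ h₂) hg _

lemma mulOp_zero : mulOp 0 = 0 := LinearMap.mulLeft_zero_eq_zero ℂ 𝓕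

lemma mulOp_one : mulOp 1 = 1 := LinearMap.mulLeft_one ℂ 𝓕

lemma lie_opL0_opL1 (hx hy : ℂ) : ⁅opL0 hx hy, opL1⁆ = (-1 : ℂ) • opL1 := by
  have h : opL1 = vecA (fun l => ((l : 𝓕) - 2) * a (l - 1)) + mulOp 1 * dX + mulOp 1 * dY
      + mulOp 0 := by
    rw [mulOp_one, mulOp_zero, one_mul, one_mul, add_zero, opL1]
  rw [h]
  refine lie_opL0 (fun l hl => ?_) (by simp) (by simp) (by simp)
  simp only [Derivation.leibniz, map_sub, Derivation.map_natCast, derivation_ofNat, euler_a,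
    Nat.cast_sub (one_le_two.trans hl), smul_eq_mul]
  algebra with ℂ

lemma lie_opL0_opL2 (hx hy : ℂ) : ⁅opL0 hx hy, opL2⁆ = (-2 : ℂ) • opL2 := by
  have h : opL2 = vecA (fun l => if l = 2 then -1 else ((l : 𝓕) - 3) * a (l - 2)) + mulOp 0 * dX
      + mulOp 0 * dY + mulOp 0 := by
    rw [mulOp_zero, zero_mul, zero_mul, add_zero, add_zero, add_zero, opL2]
  rw [h]
  refine lie_opL0 (fun l hl => ?_) (by simp) (by simp) (by simp)
  split_ifs with h2
  · simp [h2]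
  · simp only [Derivation.leibniz, map_sub, Derivation.map_natCast, derivation_ofNat, euler_a,
      Nat.cast_sub hl, smul_eq_mul]
    algebra with ℂ

lemma euler_quadratic {z : 𝓕} (hz : euler z = z) :
    euler (z ^ 2 - 3 * a 2) = ((1 : ℂ) + 1) • (z ^ 2 - 3 * a 2) := by
  simp only [Derivation.leibniz, Derivation.leibniz_pow, map_sub, derivation_ofNat, euler_a, hz,
    smul_eq_mul]
  push_cast
  algebra with ℂ

lemma euler_cubic {z : 𝓕} (hz : euler z = z) :
    euler (z ^ 3 - 4 * z * a 2 - 5 * a 3) = ((2 : ℂ) + 1) • (z ^ 3 - 4 * z * a 2 - 5 * a 3) := by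
  simp only [Derivation.leibniz, Derivation.leibniz_pow, map_sub, derivation_ofNat, euler_a, hz,
    smul_eq_mul]
  push_cast
  algebra with ℂ

lemma lie_opL0_opLm1 (hx hy : ℂ) : ⁅opL0 hx hy, opLm1 hx hy⁆ = (1 : ℂ) • opLm1 hx hy := by
  refine lie_opL0 (fun l _ => ?_) ?_ ?_ ?_
  · simp only [Derivation.leibniz, map_add, Derivation.map_natCast, derivation_ofNat, euler_a,
      euler_aSum, smul_eq_mul]
    push_cast
    algebra with ℂ
  · exact euler_quadratic euler_x
  · exact euler_quadratic euler_y
  · simp only [const, Derivation.leibniz, map_add, derivation_ofNat, Derivation.map_algebraMap,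
      euler_x, euler_y, smul_eq_mul]
    algebra with ℂ

lemma lie_opL0_opLm2 (c hx hy : ℂ) :
    ⁅opL0 hx hy, opLm2 c hx hy⁆ = (2 : ℂ) • opLm2 c hx hy := by
  refine lie_opL0 (fun l _ => ?_) ?_ ?_ ?_
  · simp only [Derivation.leibniz, map_add, map_sub, Derivation.map_natCast, derivation_ofNat,
      euler_a, euler_aSum, smul_eq_mul]
    push_cast
    algebra with ℂ
  · exact euler_cubic euler_x
  · exact euler_cubic euler_y
  · simp only [const, Derivation.leibniz, Derivation.leibniz_pow, map_add, map_sub,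
      derivation_ofNat, Derivation.map_algebraMap, euler_a, euler_x, euler_y, smul_eq_mul]
    push_cast
    algebra with ℂ

section Commutators

variable {R A : Type*} [CommRing R] [Ring A] [Algebra R A] {E S T : A} {s t : R}

lemma lie_lie_eq_smul (hS : ⁅E, S⁆ = s • S) (hT : ⁅E, T⁆ = t • T) :
    ⁅E, ⁅S, T⁆⁆ = (s + t) • ⁅S, T⁆ := by
  have jacobi : ⁅E, ⁅S, T⁆⁆ = ⁅⁅E, S⁆, T⁆ + ⁅S, ⁅E, T⁆⁆ := by
    simp only [Ring.lie_def]
    noncomm_ring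
  rw [jacobi, hS, hT]
  simp only [Ring.lie_def, smul_mul_assoc, mul_smul_comm]
  module

lemma lie_smul_eq_smul (hT : ⁅E, T⁆ = t • T) (r : R) : ⁅E, r • T⁆ = t • r • T := by
  rw [Ring.lie_def, mul_smul_comm, smul_mul_assoc, ← smul_sub, ← Ring.lie_def, hT, smul_comm]

lemma lie_iterate_lie_left (hS : ⁅E, S⁆ = s • S) (hT : ⁅E, T⁆ = t • T) (k : ℕ) :
    ⁅E, (fun U => ⁅S, U⁆)^[k] T⁆ = (k * s + t) • (fun U => ⁅S, U⁆)^[k] T := by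
  induction k with
  | zero => simpa using hT
  | succ k ih =>
    rw [Function.iterate_succ_apply', lie_lie_eq_smul hS ih]
    congr 1
    push_cast
    ring

lemma lie_iterate_lie_right (hS : ⁅E, S⁆ = s • S) (hT : ⁅E, T⁆ = t • T) (k : ℕ) :
    ⁅E, (fun U => ⁅U, S⁆)^[k] T⁆ = (k * s + t) • (fun U => ⁅U, S⁆)^[k] T := by
  induction k with
  | zero => simpa using hT
  | succ k ih =>
    rw [Function.iterate_succ_apply', lie_lie_eq_smul ih hS]
    congr 1
    push_cast
    ring

end Commutators

lemma lie_opL_zero_opL (c hx hy : ℂ) (n : ℤ) :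
    ⁅opL c hx hy 0, opL c hx hy n⁆ = (-n : ℂ) • opL c hx hy n := by
  change ⁅opL0 hx hy, _⁆ = _
  match n with
  | Int.ofNat 0 =>
    change ⁅opL0 hx hy, opL0 hx hy⁆ = _
    rw [Ring.lie_def, sub_self]
    simp
  | Int.ofNat 1 =>
    change ⁅opL0 hx hy, opL1⁆ = _ • opL1
    simpa using lie_opL0_opL1 hx hy
  | Int.ofNat (k + 2) =>
    rw [opL, lie_smul_eq_smul
      (lie_iterate_lie_right (lie_opL0_opL1 hx hy) (lie_opL0_opL2 hx hy) k)]
    congr 1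
    rw [Int.ofNat_eq_natCast]
    push_cast
    ring
  | Int.negSucc 0 =>
    change ⁅opL0 hx hy, opLm1 hx hy⁆ = _ • opLm1 hx hy
    simpa using lie_opL0_opLm1 hx hy
  | Int.negSucc (k + 1) =>
    rw [opL, lie_smul_eq_smul
      (lie_iterate_lie_left (lie_opL0_opLm1 hx hy) (lie_opL0_opLm2 c hx hy) k)]
    congr 1
    push_cast
    ring

section Eigenspaces

variable {R M : Type*} [CommRing R] [AddCommGroup M] [Module R M] {T : Module.End R M}

lemma map_mem_eigenspace_of_lie_eq_smul {S : Module.End R M} {d μ : R} (hS : ⁅T, S⁆ = d • S)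
    {v : M} (hv : v ∈ T.eigenspace μ) : S v ∈ T.eigenspace (μ + d) := by
  rw [Module.End.mem_eigenspace_iff] at hv ⊢
  have hcomm := LinearMap.congr_fun hS v
  rw [Ring.lie_def, LinearMap.sub_apply, Module.End.mul_apply, Module.End.mul_apply, hv, map_smul,
    LinearMap.smul_apply, sub_eq_iff_eq_add'] at hcomm
  rw [hcomm, add_smul]

lemma sub_smul_mem_iSup_eigenspace_ne (t : R) {v : M} (hv : v ∈ ⨆ μ, T.eigenspace μ) :
    T v - t • v ∈ ⨆ (μ) (_ : μ ≠ t), T.eigenspace μ := by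
  change (T - algebraMap R (Module.End R M) t) v ∈ _
  induction hv using Submodule.iSup_induction' with
  | mem μ v hv =>
    have hTv : (T - algebraMap R (Module.End R M) t) v = (μ - t) • v := by
      rw [LinearMap.sub_apply, Module.End.mem_eigenspace_iff.1 hv, Module.algebraMap_end_apply,
        sub_smul]
    rw [hTv]
    rcases eq_or_ne μ t with rfl | hμ
    · rw [sub_self, zero_smul]; exact zero_mem _
    · exact Submodule.smul_mem _ _ (Submodule.mem_iSup_of_mem μ (Submodule.mem_iSup_of_mem hμ hv))
  | zero => rw [map_zero]; exact zero_mem _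
  | add v w _ _ hv hw => rw [map_add]; exact add_mem hv hw

lemma sub_smul_eq_zero_of_mem_iSup_eigenspace [IsDomain R] [Module.IsTorsionFree R M]
    {t : R} {v : M} (hv : v ∈ ⨆ μ, T.eigenspace μ) (ht : T v - t • v ∈ T.eigenspace t) :
    T v - t • v = 0 :=
  Submodule.disjoint_def.1 (T.eigenspaces_iSupIndep t) _ ht (sub_smul_mem_iSup_eigenspace_ne t hv)

end Eigenspaces

section Modules

variable {V : Type*} [AddCommGroup V] [Module ℂ V] {L : ℤ → Module.End ℂ V}

lemma mem_generated_self (w : V) : w ∈ generated L w := ⟨1, Subalgebra.one_mem _, rfl⟩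

lemma apply_mem_generated {u : Module.End ℂ V} (hu : u ∈ Algebra.adjoin ℂ (Set.range L)) {v w : V}
    (hv : v ∈ generated L w) : u v ∈ generated L w := by
  obtain ⟨u', hu', rfl⟩ := hv
  exact ⟨u * u', Subalgebra.mul_mem _ hu hu', rfl⟩

lemma mem_adjoin_range (n : ℤ) : L n ∈ Algebra.adjoin ℂ (Set.range L) :=
  Algebra.subset_adjoin ⟨n, rfl⟩

lemma sq_sub_smul_mem_adjoin_range (m n : ℤ) (t : ℂ) :
    L m ^ 2 - t • L n ∈ Algebra.adjoin ℂ (Set.range L) :=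
  sub_mem (pow_mem (mem_adjoin_range m) 2) (Subalgebra.smul_mem _ (mem_adjoin_range n) t)

lemma generated_le {w : V} {N : Submodule ℂ V} (hN : ∀ n, ∀ v ∈ N, L n v ∈ N) (hw : w ∈ N) :
    generated L w ≤ N := by
  rintro _ ⟨u, hu, rfl⟩
  suffices h : ∀ v ∈ N, u v ∈ N from h w hw
  refine Algebra.adjoin_induction (p := fun u _ => ∀ v ∈ N, u v ∈ N) ?_ ?_ ?_ ?_ hu
  · rintro _ ⟨n, rfl⟩
    exact hN n
  · exact fun t v hv => N.smul_mem t hv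
  · exact fun S T _ _ hS hT v hv => N.add_mem (hS v hv) (hT v hv)
  · exact fun S T _ _ hS hT v hv => hS _ (hT v hv)

lemma generated_le_generated {v w : V} (hv : v ∈ generated L w) : generated L v ≤ generated L w :=
  generated_le (fun n _ => apply_mem_generated (mem_adjoin_range n)) hv

lemma generated_le_iSup_eigenspace {d : ℤ → ℂ} (hL : ∀ n, ⁅L 0, L n⁆ = d n • L n) {w : V} {h : ℂ}
    (hw : L 0 w = h • w) : generated L w ≤ ⨆ μ, (L 0).eigenspace μ := by
  refine generated_le (fun n v hv => ?_)
    (Submodule.mem_iSup_of_mem h (Module.End.mem_eigenspace_iff.2 hw))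
  induction hv using Submodule.iSup_induction' with
  | mem μ v hv =>
    exact Submodule.mem_iSup_of_mem _ (map_mem_eigenspace_of_lie_eq_smul (hL n) hv)
  | zero => rw [map_zero]; exact zero_mem _
  | add v w _ _ hv hw => rw [map_add]; exact add_mem hv hw

lemma IsHighestWeightVector.smul {h t : ℂ} {w : V} (hw : IsHighestWeightVector L h w) (ht : t ≠ 0) :
    IsHighestWeightVector L h (t • w) :=
  ⟨smul_ne_zero ht hw.1, by rw [map_smul, hw.2.1, smul_comm],
    fun n hn => by rw [map_smul, hw.2.2 n hn, smul_zero]⟩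

/-- `Λ` is a logarithmic partner of the singular vector `χ Z` in the highest weight module `𝒰 Z`:
`L₀ - h'` sends `Λ` to `χ Z`, the `L_n` with `n > 0` send it to `𝒰 Z`, and the raising operator
`χd` sends it to `β Z ≠ 0`. -/
structure IsLogPartner (L : ℤ → Module.End ℂ V) (h h' : ℂ) (χ χd : Module.End ℂ V) (β : ℂ)
    (Z Λ : V) : Prop where
  mem_adjoin : χ ∈ Algebra.adjoin ℂ (Set.range L)
  raising_mem_adjoin : χd ∈ Algebra.adjoin ℂ (Set.range L)
  isHighestWeightVector : IsHighestWeightVector L h Z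
  singular : IsHighestWeightVector L h' (χ Z)
  sub_smul_eq : L 0 Λ - h' • Λ = χ Z
  apply_mem : ∀ n : ℤ, 0 < n → L n Λ ∈ generated L Z
  coupling_ne_zero : β ≠ 0
  raising_eq : χd Λ = β • Z

namespace IsLogPartner

variable {h h' β : ℂ} {χ χd : Module.End ℂ V} {Z Λ : V}

lemma generated_le (hΛ : IsLogPartner L h h' χ χd β Z Λ) : generated L Z ≤ generated L Λ := by
  refine generated_le_generated ?_
  rw [← inv_smul_smul₀ hΛ.coupling_ne_zero Z, ← hΛ.raising_eq]
  exact Submodule.smul_mem _ _ (apply_mem_generated hΛ.raising_mem_adjoin (mem_generated_self Λ))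

lemma notMem_iSup_eigenspace (hΛ : IsLogPartner L h h' χ χd β Z Λ) :
    Λ ∉ ⨆ μ, (L 0).eigenspace μ := by
  intro hmem
  refine hΛ.singular.1 (hΛ.sub_smul_eq ▸ sub_smul_eq_zero_of_mem_iSup_eigenspace hmem ?_)
  rw [hΛ.sub_smul_eq, Module.End.mem_eigenspace_iff]
  exact hΛ.singular.2.1

variable {d : ℤ → ℂ}

lemma isHighestWeightVectorMod (hΛ : IsLogPartner L h h' χ χd β Z Λ)
    (hL : ∀ n, ⁅L 0, L n⁆ = d n • L n) :
    IsHighestWeightVectorMod L (generated L Z) (generated L Λ) h' Λ := by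
  refine ⟨mem_generated_self Λ, fun hmem => ?_, ?_, hΛ.apply_mem, sup_eq_right.2 hΛ.generated_le⟩
  · exact hΛ.notMem_iSup_eigenspace
      (generated_le_iSup_eigenspace hL hΛ.isHighestWeightVector.2.1 hmem)
  · rw [hΛ.sub_smul_eq]
    exact apply_mem_generated hΛ.mem_adjoin (mem_generated_self Z)

lemma isStaggered (hΛ : IsLogPartner L h h' χ χd β Z Λ) (hL : ∀ n, ⁅L 0, L n⁆ = d n • L n) :
    IsStaggered L (generated L Z) (generated L Λ) h h' := by
  refine ⟨hΛ.generated_le, fun n _ => apply_mem_generated (mem_adjoin_range n),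
    ⟨Z, hΛ.isHighestWeightVector, rfl⟩, ⟨Λ, hΛ.isHighestWeightVectorMod hL⟩, fun hdiag => ?_⟩
  have hle : generated L Λ ≤ ⨆ μ, (L 0).eigenspace μ :=
    hdiag.ge.trans (iSup_mono fun _ => inf_le_right)
  exact hΛ.notMem_iSup_eigenspace (hle (mem_generated_self Λ))

lemma isLogCoupling (hΛ : IsLogPartner L h h' χ χd β Z Λ) (hL : ∀ n, ⁅L 0, L n⁆ = d n • L n) :
    IsLogCoupling L (generated L Z) (generated L Λ) h h' χ χd β :=
  ⟨Z, Λ, hΛ.isHighestWeightVector, rfl, hΛ.isHighestWeightVectorMod hL, hΛ.singular,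
    hΛ.sub_smul_eq, hΛ.raising_eq⟩

end IsLogPartner

end Modules

/-! ### Local martingales -/

variable {κ : ℝ}

lemma indicial_eq_mul (hκ : κ ≠ 0) (ρ s : ℝ) :
    indicial κ ρ s = κ / 2 * ((s - ρ / κ) * (s - (1 - 4 / κ - ρ / κ))) := by
  rw [indicial]
  field_simp
  ring

lemma partitionFunction_mem_localMartingales (hκ : κ ≠ 0) (ρ : ℝ) :
    partitionFunction κ ρ ∈ localMartingales κ ρ := by
  rw [localMartingales, LinearMap.mem_ker, partitionFunction, opA_coe_powXY,
    indicial_eq_mul hκ, sub_self, zero_mul, mul_zero, Complex.ofReal_zero, zero_smul]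

lemma coe_logXYAnsatz_mem_localMartingales {ρ s : ℝ} {A B : ℂ} (hs : indicial κ ρ s = 0)
    (hs2 : indicial κ ρ (s + 2) = 0) (hAB : κ * s * A = 2 * B)
    (hlog : (κ / 2 * (2 * (s + 2) - 1) + 2 : ℝ) + 4 * B + κ * A = 0) :
    coe (logXYAnsatz s A B) ∈ localMartingales κ ρ := by
  have hpow : powXY (s - 1) * ((2 * κ * s * A) • xS - (4 * B) • yS) = (4 * B) • powXY s := by
    have hsplit : powXY s = powXY (s - 1) * (xS - yS) := by
      rw [← powXY_one, ← powXY_add, sub_add_cancel]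
    rw [show 2 * κ * s * A = 4 * B by linear_combination 2 * hAB, ← smul_sub, hsplit,
      mul_smul_comm]
  rw [localMartingales, LinearMap.mem_ker, logXYAnsatz, coe_add, map_add, opA_coe_powXY_mul_logXY,
    opA_coe_powXY_mul_quadratic, hs, hs2, hpow, Complex.ofReal_zero, zero_smul, zero_smul, zero_add,
    zero_add, add_sub_cancel_right, ← add_smul, coe_smul, ← add_smul, ← add_assoc, hlog, zero_smul]

/-! ### The resonance at `ρ = -(κ+4)/2` -/

/-- The drift parameter `ρ = -(κ+4)/2`, for which the roots of the indicial polynomial of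
`A_{κ;ρ}` differ by `2`. -/
abbrev resonantRho (κ : ℝ) : ℝ := -(κ + 4) / 2

/-- The operator `χ = L₋₁² - κ/4 L₋₂` which produces a singular vector from a highest weight vector
of weight `h_{2,1}`. -/
abbrev singularOp (κ : ℝ) : Op :=
  vir κ (resonantRho κ) (-1) ^ 2 - ((κ / 4 : ℝ) : ℂ) • vir κ (resonantRho κ) (-2)

/-- The operator `χ† = L₁² - κ/4 L₂`, in which the order of the `L_n` in `χ` is reversed and `L_n`
is replaced by `L₋ₙ`. -/
abbrev raisingOp (κ : ℝ) : Op :=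
  vir κ (resonantRho κ) 1 ^ 2 - ((κ / 4 : ℝ) : ℂ) • vir κ (resonantRho κ) 2

/-- The logarithmic coupling `β = -(κ-4)(κ-2)(κ+4)/16`. -/
abbrev logCoupling (κ : ℝ) : ℝ := -(1 / 16) * (κ - 4) * (κ - 2) * (κ + 4)

lemma partitionFunction_eq (hκ : κ ≠ 0) :
    partitionFunction κ (resonantRho κ) = coe (powXY (-(1 / 2) - 2 / κ)) := by
  rw [partitionFunction]
  congr 2
  field_simp
  ring

lemma logPartner_eq (hκ : κ ≠ 0) :
    logPartner κ = (singConst κ : ℂ)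
      • coe (logXYAnsatz (-(1 / 2) - 2 / κ) (κ / 4) (-(4 * κ + κ ^ 2) / 16)) := by
  have hlog : (3 * κ - 4) / (2 * κ) = -(1 / 2) - 2 / κ + 2 := by field_simp; ring
  have hquad : (-κ - 4) / (2 * κ) = -(1 / 2) - 2 / κ := by field_simp; ring
  rw [logPartner, coe_smul, logXYAnsatz, hlog, hquad]
  congr 4
  module

lemma kacWeight_two_one (κ : ℝ) : kacWeight κ 2 1 = (3 * κ - 8) / 16 := by
  rw [kacWeight]
  push_cast
  ring

lemma weight_eq_kacWeight (hκ : κ ≠ 0) :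
    ((-(1 / 2) - 2 / κ : ℝ) : ℂ) + (kacWeight κ 1 2 : ℝ)
      + (resonantRho κ * (resonantRho κ + 4 - κ) / (4 * κ) : ℝ) = (kacWeight κ 2 1 : ℝ) := by
  norm_cast
  rw [kacWeight_two_one, kacWeight]
  field_simp
  push_cast
  ring

lemma vir_neg_two (κ ρ : ℝ) :
    vir κ ρ (-2) = opLm2 (centralCharge κ : ℝ) (kacWeight κ 1 2 : ℝ)
      (ρ * (ρ + 4 - κ) / (4 * κ) : ℝ) := by
  change ((Nat.factorial 0 : ℂ)⁻¹) • opLm2 _ _ _ = opLm2 _ _ _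
  simp

lemma isHighestWeightVector_partitionFunction (hκ : κ ≠ 0) :
    IsHighestWeightVector (vir κ (resonantRho κ)) (kacWeight κ 2 1 : ℝ)
      (partitionFunction κ (resonantRho κ)) := by
  rw [partitionFunction_eq hκ, ← weight_eq_kacWeight hκ]
  exact isHighestWeightVector_coe_powXY _ _ _ _

lemma singularOp_partitionFunction (hκ : κ ≠ 0) :
    singularOp κ (partitionFunction κ (resonantRho κ))
      = (singConst κ : ℂ) • coe (powXY (3 / 2 - 2 / κ)) := by
  rw [singularOp, partitionFunction_eq hκ, vir_neg_two,
    show (3 / 2 - 2 / κ : ℝ) = -(1 / 2) - 2 / κ + 2 by ring]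
  refine levelTwo_coe_powXY ?_ ?_ ?_ ?_ <;>
  · norm_cast
    simp only [kacWeight, singConst, centralCharge]
    push_cast
    field_simp
    ring

lemma singConst_ne_zero (hκ : κ ≠ 0) (hκ' : κ ≠ -4) (h2 : κ ≠ 2) (h4 : κ ≠ 4) :
    singConst κ ≠ 0 :=
  div_ne_zero (mul_ne_zero (mul_ne_zero (sub_ne_zero.2 h4) (sub_ne_zero.2 h2))
    (mt eq_neg_of_add_eq_zero_left hκ')) (mul_ne_zero two_ne_zero (pow_ne_zero 2 hκ))

lemma isHighestWeightVector_singularOp_partitionFunction (hκ : κ ≠ 0) (hκ' : κ ≠ -4)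
    (h2 : κ ≠ 2) (h4 : κ ≠ 4) :
    IsHighestWeightVector (vir κ (resonantRho κ)) ((kacWeight κ 2 1 : ℝ) + 2)
      (singularOp κ (partitionFunction κ (resonantRho κ))) := by
  have hweight : (kacWeight κ 2 1 : ℝ) + (2 : ℂ) = ((3 / 2 - 2 / κ : ℝ) : ℂ)
      + (kacWeight κ 1 2 : ℝ) + (resonantRho κ * (resonantRho κ + 4 - κ) / (4 * κ) : ℝ) := by
    rw [← weight_eq_kacWeight hκ]
    push_cast
    ring
  rw [singularOp_partitionFunction hκ, hweight]
  exact (isHighestWeightVector_coe_powXY _ _ _ _).smul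
    (Complex.ofReal_ne_zero.2 (singConst_ne_zero hκ hκ' h2 h4))

lemma logPartner_mem_localMartingales (hκ : κ ≠ 0) :
    logPartner κ ∈ localMartingales κ (resonantRho κ) := by
  rw [logPartner_eq hκ]
  refine Submodule.smul_mem _ _ (coe_logXYAnsatz_mem_localMartingales ?_ ?_ ?_ ?_)
  · rw [indicial_eq_mul hκ]
    field_simp
    ring
  · rw [indicial_eq_mul hκ]
    field_simp
    ring
  · norm_cast
    field_simp
    ring
  · norm_cast
    field_simp
    ring

lemma vir_zero_logPartner (hκ : κ ≠ 0) :
    vir κ (resonantRho κ) 0 (logPartner κ) - ((kacWeight κ 2 1 : ℝ) + 2 : ℂ) • logPartner κ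
      = singularOp κ (partitionFunction κ (resonantRho κ)) := by
  rw [singularOp_partitionFunction hκ]
  change opL0 _ _ _ - _ = _
  rw [logPartner_eq hκ, map_smul, opL0_coe_logXYAnsatz, weight_eq_kacWeight hκ,
    show (3 / 2 - 2 / κ : ℝ) = -(1 / 2) - 2 / κ + 2 by ring]
  module

lemma vir_coe_of_two_le {ρ : ℝ} {n : ℤ} (hn : 2 ≤ n) (f : Smooth) : vir κ ρ n (coe f) = 0 :=
  opL_coe_of_two_le _ _ _ hn f

lemma smul_vir_one_logPartner (hκ : κ ≠ 0) :
    (8 - 3 * κ : ℂ) • vir κ (resonantRho κ) 1 (logPartner κ)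
      = (κ ^ 2 * singConst κ : ℂ)
        • vir κ (resonantRho κ) (-1) (partitionFunction κ (resonantRho κ)) := by
  change _ • opL1 _ = _ • opLm1 _ _ _
  rw [logPartner_eq hκ, partitionFunction_eq hκ, map_smul, opL1_coe_logXYAnsatz,
    opLm1_coe_powXY, smul_smul, ← coe_smul, ← coe_smul, ← smul_mul_assoc, ← smul_mul_assoc,
    smul_add, smul_add, smul_smul, smul_smul, smul_smul, smul_smul]
  congr 4
  · norm_cast
    rw [kacWeight]
    push_cast
    field_simp
    ring
  · norm_cast
    field_simp
    ring

lemma vir_logPartner_mem_generated (hκ : κ ≠ 0) (h83 : κ ≠ 8 / 3) {n : ℤ} (hn : 0 < n) :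
    vir κ (resonantRho κ) n (logPartner κ)
      ∈ generated (vir κ (resonantRho κ)) (partitionFunction κ (resonantRho κ)) := by
  obtain rfl | h1 : 1 = n ∨ 1 < n := (Int.add_one_le_iff.2 hn).eq_or_lt
  · have hne : (8 - 3 * κ : ℂ) ≠ 0 := by
      norm_cast
      exact fun h => h83 (by linarith)
    rw [← Submodule.smul_mem_iff _ hne, smul_vir_one_logPartner hκ]
    exact Submodule.smul_mem _ _
      (apply_mem_generated (mem_adjoin_range (-1)) (mem_generated_self _))
  · rw [logPartner, vir_coe_of_two_le (Int.add_one_le_iff.2 h1)]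
    exact zero_mem _

lemma raisingOp_logPartner (hκ : κ ≠ 0) :
    raisingOp κ (logPartner κ)
      = (logCoupling κ : ℂ) • partitionFunction κ (resonantRho κ) := by
  have hL2 : vir κ (resonantRho κ) 2 (logPartner κ) = 0 := vir_coe_of_two_le le_rfl _
  rw [LinearMap.sub_apply, LinearMap.smul_apply, hL2, smul_zero, sub_zero]
  change (opL1 ^ 2) _ = _
  rw [logPartner_eq hκ, partitionFunction_eq hκ, map_smul, opL1_sq_coe_logXYAnsatz, smul_smul]
  congr 1
  norm_cast
  rw [singConst]
  field_simp
  ring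

lemma logCoupling_eq (hκ : κ ≠ 0) :
    logCoupling κ = -(κ ^ 2 / 8) * singConst κ := by
  rw [singConst]
  field_simp
  ring

lemma isLogPartner_logPartner (hκ : κ ≠ 0) (hκ' : κ ≠ -4) (h2 : κ ≠ 2) (h4 : κ ≠ 4)
    (h83 : κ ≠ 8 / 3) :
    IsLogPartner (vir κ (resonantRho κ)) (kacWeight κ 2 1 : ℝ) ((kacWeight κ 2 1 : ℝ) + 2)
      (singularOp κ) (raisingOp κ) (logCoupling κ : ℂ) (partitionFunction κ (resonantRho κ))
      (logPartner κ) where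
  mem_adjoin := sq_sub_smul_mem_adjoin_range _ _ _
  raising_mem_adjoin := sq_sub_smul_mem_adjoin_range _ _ _
  isHighestWeightVector := isHighestWeightVector_partitionFunction hκ
  singular := isHighestWeightVector_singularOp_partitionFunction hκ hκ' h2 h4
  sub_smul_eq := vir_zero_logPartner hκ
  apply_mem := fun _ => vir_logPartner_mem_generated hκ h83
  coupling_ne_zero := by
    rw [logCoupling_eq hκ]
    exact Complex.ofReal_ne_zero.2 (mul_ne_zero
      (neg_ne_zero.2 (div_ne_zero (pow_ne_zero 2 hκ) (by norm_num)))
      (singConst_ne_zero hκ hκ' h2 h4))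
  raising_eq := raisingOp_logPartner hκ

end SLEVir

end

open SLEVir in
theorem mainTheorem4_general (κ : ℝ) (hκ : κ ≠ 0) (hκ' : κ ≠ -4) :
    let ρ : ℝ := -(κ + 4) / 2
    let L : ℤ → Op := vir κ ρ
    let h : ℂ := (kacWeight κ 2 1 : ℝ)
    let Z : 𝓕 := partitionFunction κ ρ
    let χ : Op := L (-1) ^ 2 - ((κ / 4 : ℝ) : ℂ) • L (-2)
    let χd : Op := L 1 ^ 2 - ((κ / 4 : ℝ) : ℂ) • L 2
    let Λ : 𝓕 := logPartner κ
    let β : ℂ := ((-(1 / 16) * (κ - 4) * (κ - 2) * (κ + 4) : ℝ) : ℂ)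
    Z = coe (powXY (-(1 / 2) - 2 / κ)) ∧
    Z ∈ localMartingales κ ρ ∧
    kacWeight κ 2 1 = (3 * κ - 8) / 16 ∧
    IsHighestWeightVector L h Z ∧
    χ Z = (singConst κ : ℂ) • coe (powXY (3 / 2 - 2 / κ)) ∧
    (κ ≠ 2 → κ ≠ 4 → IsHighestWeightVector L (h + 2) (χ Z)) ∧
    Λ ∈ localMartingales κ ρ ∧
    L 0 Λ - (h + 2) • Λ = χ Z ∧
    (κ ≠ 8 / 3 → ∀ n : ℤ, 0 < n → L n Λ ∈ generated L Z) ∧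
    χd Λ = β • Z ∧
    (κ ≠ 2 → κ ≠ 4 → κ ≠ 8 / 3 →
      IsStaggered L (generated L Z) (generated L Λ) h (h + 2) ∧
      IsLogCoupling L (generated L Z) (generated L Λ) h (h + 2) χ χd β) := by
  intro ρ L h Z χ χd Λ β
  have hlog (h2 : κ ≠ 2) (h4 : κ ≠ 4) (h83 : κ ≠ 8 / 3) :
      IsLogPartner L h (h + 2) χ χd β Z Λ :=
    isLogPartner_logPartner hκ hκ' h2 h4 h83
  have hgrading (n : ℤ) : ⁅L 0, L n⁆ = (-n : ℂ) • L n := lie_opL_zero_opL _ _ _ n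
  refine ⟨partitionFunction_eq hκ, partitionFunction_mem_localMartingales hκ ρ,
    kacWeight_two_one κ, isHighestWeightVector_partitionFunction hκ,
    singularOp_partitionFunction hκ,
    isHighestWeightVector_singularOp_partitionFunction hκ hκ',
    logPartner_mem_localMartingales hκ, vir_zero_logPartner hκ,
    fun h83 n => vir_logPartner_mem_generated hκ h83,
    raisingOp_logPartner hκ, fun h2 h4 h83 => ?_⟩
  exact ⟨(hlog h2 h4 h83).isStaggered hgrading, (hlog h2 h4 h83).isLogCoupling hgrading⟩

theorem mainTheorem4 (κ : ℝ) (hκ : 0 < κ) :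
    let ρ : ℝ := -(κ + 4) / 2
    let L : ℤ → SLEVir.Op := SLEVir.vir κ ρ
    let h : ℂ := (SLEVir.kacWeight κ 2 1 : ℝ)
    let Z : SLEVir.𝓕 := SLEVir.partitionFunction κ ρ
    let χ : SLEVir.Op := L (-1) ^ 2 - ((κ / 4 : ℝ) : ℂ) • L (-2)
    let χd : SLEVir.Op := L 1 ^ 2 - ((κ / 4 : ℝ) : ℂ) • L 2
    let Λ : SLEVir.𝓕 := SLEVir.logPartner κ
    let β : ℂ := ((-(1 / 16) * (κ - 4) * (κ - 2) * (κ + 4) : ℝ) : ℂ)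
    -- `Z = (x - y)^{-1/2 - 2/κ}` is a local martingale, a highest weight vector of weight `h_{2,1}`
    Z = SLEVir.coe (SLEVir.powXY (-(1 / 2) - 2 / κ)) ∧
    Z ∈ SLEVir.localMartingales κ ρ ∧
    SLEVir.kacWeight κ 2 1 = (3 * κ - 8) / 16 ∧
    SLEVir.IsHighestWeightVector L h Z ∧
    -- the vector at grade two of `𝒰 Z`; it is a nonzero singular vector if `κ ≠ 2, 4`
    χ Z = (SLEVir.singConst κ : ℂ) • SLEVir.coe (SLEVir.powXY (3 / 2 - 2 / κ)) ∧
    (κ ≠ 2 → κ ≠ 4 → SLEVir.IsHighestWeightVector L (h + 2) (χ Z)) ∧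
    -- the logarithmic partner
    Λ ∈ SLEVir.localMartingales κ ρ ∧
    L 0 Λ - (h + 2) • Λ = χ Z ∧
    (κ ≠ 8 / 3 → ∀ n : ℤ, 0 < n → L n Λ ∈ SLEVir.generated L Z) ∧
    -- the logarithmic coupling
    χd Λ = β • Z ∧
    (κ ≠ 2 → κ ≠ 4 → κ ≠ 8 / 3 →
      SLEVir.IsStaggered L (SLEVir.generated L Z) (SLEVir.generated L Λ) h (h + 2) ∧
      SLEVir.IsLogCoupling L (SLEVir.generated L Z) (SLEVir.generated L Λ) h (h + 2) χ χd β) := by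
  exact mainTheorem4_general κ hκ.ne' (by linarith)
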